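/- Let $p$ be a prime and let $(R,\mathfrak m)$ be an $F$-finite noetherian local ring of characteristic $p$ and dimension $d\ge 2$. Let $\mathfrak a_1,\mathfrak a_2\subset R$ be ideals with $\mathfrak a_1\cap\mathfrak a_2=0$ and $\dim R/\mathfrak a_1=\dim R/\mathfrak a_2=d$, and put $\mathfrak b=\mathfrak a_1+\mathfrak a_2$. Notation. For a noetherian local ring $A$ of characteristic $p$ and maximal ideal $\mathfrak m$, the local cohomology modules $H^j_{\mathfrak m}(A)$ carry the Frobenius action $F$ induced by the Frobenius endomorphism of the Čech complex, and $H^j_{\mathfrak m}(A)=0$ for $j<0$. For a module $M$ with Frobenius action $\rho$, $M$ is nilpotent if each $m\in M$ satisfies $\rho^e(m)=0$ for some $e\in\mathbf N$, and $\operatorname{HSL} M\in\mathbf N\cup\{\infty\}$ is the least $e\in\mathbf N$ such that $\rho^e$ kills every element of $M$ that is killed by some power of $\rho$. $\operatorname{F-depth} A\in\mathbf N\cup\{\infty\}$ is the least $j$ for which $H^j_{\mathfrak m}(A)$ is not nilpotent, and $A$ is weakly $F$-nilpotent if $H^j_{\mathfrak m}(A)$ is nilpotent for all $j<\dim A$.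 For an ideal $J\subset R$, $J^{[p^e]}$ is the ideal generated by the $p^e$-th powers of the elements of $J$, $J^F=\{x\in R: x^{p^e}\in J^{[p^e]}\text{ for some }e\in\mathbf N\}$, and $\operatorname{Fte} J=\min\{e\in\mathbf N:(J^F)^{[p^e]}=J^{[p^e]}\}$. Finally $\operatorname{Fte} R\in\mathbf N\cup\{\infty\}$ is the supremum of $\operatorname{Fte}\mathfrak q$ over all parameter ideals $\mathfrak q$ of $R$, i.e. ideals whose height equals their minimal number of generators. Put $$h_j=\max\{\operatorname{HSL} H^j_{\mathfrak m}(R/\mathfrak a_1),\ \operatorname{HSL} H^j_{\mathfrak m}(R/\mathfrak a_2)\}.$$ Theorem. For every integer $j\ge 0$ with $j\le\operatorname{F-depth} R/\mathfrak b$, $$\operatorname{HSL} H^j_{\mathfrak m}(R)\ \le\ \operatorname{HSL} H^{j-1}_{\mathfrak m}(R/\mathfrak b)+h_j .\qquad(*)$$ Suppose in addition that $R/\mathfrak a_1$, $R/\mathfrak a_2$ and $R/\mathfrak b$ are weakly $F$-nilpotent. (1) If $\dim R/\mathfrak b=d$, then $(*)$ holds for all $j\ge 0$, and $$\operatorname{Fte}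 R\ \le\ \sum_{j=1}^{d}\binom dj\operatorname{HSL} H^{j-1}_{\mathfrak m}(R/\mathfrak b)+\sum_{j=0}^{d}\binom dj h_j .$$ (2) If $\dim R/\mathfrak b=d-1$, then $(*)$ holds for $0\le j<d$, and $$\operatorname{Fte} R\ \le\ \operatorname{HSL} H^d_{\mathfrak m}(R)+\sum_{j=1}^{d-1}\binom dj\operatorname{HSL} H^{j-1}_{\mathfrak m}(R/\mathfrak b)+\sum_{j=0}^{d-1}\binom dj h_j .$$ -/

import Mathlib

/-! Rings of prime characteristic `p` are commutative rings carrying an algebra structure over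
`ZMod p`.  On a nonzero ring this is the same thing as `CharP A p` (such a structure is unique). -/

noncomputable section

namespace FrobeniusGluing

/-! ### The Frobenius endomorphism and Frobenius powers of ideals -/

section Frobenius

variable (p : ℕ) [Fact p.Prime]

/-- The Frobenius endomorphism `x ↦ x ^ p` of an `𝔽_p`-algebra (the zero ring is allowed, since
some localizations appearing below may vanish). -/
def frob (A : Type*) [CommRing A] [Algebra (ZMod p) A] : A →+* A where
  toFun x := x ^ p
  map_one' := one_pow p
  map_mul' x y := mul_pow x y p
  map_zero' := zero_pow (Fact.out : p.Prime).ne_zero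
  map_add' x y := by
    obtain ⟨r, hr⟩ := exists_add_pow_prime_eq (Fact.out : p.Prime) x y
    have h0 : (p : A) = 0 := by
      rw [← map_natCast (algebraMap (ZMod p) A) p, ZMod.natCast_self, map_zero]
    rw [hr, h0]; ring

/-- `A` is `F`-finite: the Frobenius endomorphism is a finite ring homomorphism. -/
def FFinite (A : Type*) [CommRing A] [Algebra (ZMod p) A] : Prop :=
  (frob p A).Finite

lemma frob_iterate (A : Type*) [CommRing A] [Algebra (ZMod p) A] (e : ℕ) (x : A) :
    (frob p A)^[e] x = x ^ p ^ e := by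
  induction e with
  | zero => simp
  | succ e ih =>
    rw [Function.iterate_succ_apply', ih, pow_succ, pow_mul]; rfl

lemma add_pow_frob {A : Type*} [CommRing A] [Algebra (ZMod p) A] (e : ℕ) (x y : A) :
    (x + y) ^ p ^ e = x ^ p ^ e + y ^ p ^ e := by
  rw [← frob_iterate p A, ← frob_iterate p A, ← frob_iterate p A, iterate_map_add]

/-- The Frobenius power `J^{[p^e]}`, generated by the `p^e`-th powers of the elements of `J`. -/
def frobPow (p : ℕ) {A : Type*} [CommRing A] (e : ℕ) (J : Ideal A) : Ideal A :=
  Ideal.span ((fun x : A => x ^ p ^ e) '' (J : Set A))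

lemma pow_mem_frobPow_add {A : Type*} [CommRing A] [Algebra (ZMod p) A] (J : Ideal A)
    (e f : ℕ) {x : A} (hx : x ∈ frobPow p e J) : x ^ p ^ f ∈ frobPow p (e + f) J := by
  refine Submodule.span_induction (p := fun x _ => x ^ p ^ f ∈ frobPow p (e + f) J)
    ?_ ?_ ?_ ?_ hx
  · rintro _ ⟨y, hy, rfl⟩
    refine Ideal.subset_span ⟨y, hy, ?_⟩
    simp only [pow_add, pow_mul]
  · rw [zero_pow (pow_ne_zero _ (Fact.out : p.Prime).ne_zero)]
    exact Ideal.zero_mem _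
  · intro x y _ _ hx hy
    rw [add_pow_frob]
    exact Ideal.add_mem _ hx hy
  · intro a x _ hx
    rw [smul_eq_mul, mul_pow]
    exact Ideal.mul_mem_left _ _ hx

/-- The Frobenius closure `J^F = {x | x^{p^e} ∈ J^{[p^e]} for some e}`. -/
def frobClosure {A : Type*} [CommRing A] [Algebra (ZMod p) A] (J : Ideal A) : Ideal A where
  carrier := {x | ∃ e : ℕ, x ^ p ^ e ∈ frobPow p e J}
  zero_mem' := ⟨0, by simp⟩
  add_mem' := by
    rintro x y ⟨e, he⟩ ⟨f, hf⟩
    refine ⟨e + f, ?_⟩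
    rw [add_pow_frob]
    refine Ideal.add_mem _ ?_ ?_
    · rw [pow_add, pow_mul]; exact pow_mem_frobPow_add p J e f he
    · rw [add_comm, pow_add, pow_mul]; exact pow_mem_frobPow_add p J f e hf
  smul_mem' := by
    rintro a x ⟨e, he⟩
    refine ⟨e, ?_⟩
    rw [smul_eq_mul, mul_pow]
    exact Ideal.mul_mem_left _ _ he

/-- The Frobenius test exponent of an ideal: the least `e` with `(J^F)^{[p^e]} = J^{[p^e]}`. -/
def fteIdeal {A : Type*} [CommRing A] [Algebra (ZMod p) A] (J : Ideal A) : ℕ∞ :=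
  ⨅ (e : ℕ) (_ : frobPow p e (frobClosure p J) = frobPow p e J), (e : ℕ∞)

/-- A parameter ideal is an ideal whose height equals its minimal number of generators. -/
def IsParameterIdeal {A : Type*} [CommRing A] (q : Ideal A) : Prop :=
  q.height = (q.spanFinrank : ℕ∞)

/-- The Frobenius test exponent of a ring: the supremum of the Frobenius test exponents of its
parameter ideals. -/
def fte (A : Type*) [CommRing A] [Algebra (ZMod p) A] : ℕ∞ :=
  ⨆ (q : Ideal A) (_ : IsParameterIdeal q), fteIdeal p q

end Frobenius

/-! ### Modules with a Frobenius action -/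

section Action

variable {p : ℕ} [Fact p.Prime] {A : Type*} [CommRing A] [Algebra (ZMod p) A]
  {M : Type*} [AddCommGroup M] [Module A M]

/-- A module with Frobenius action `ρ` (an additive map with `ρ (a m) = a ^ p ρ m`) is nilpotent
if every element is killed by some iterate of `ρ`. -/
def IsNilpotentAction (ρ : M →ₛₗ[frob p A] M) : Prop :=
  ∀ m : M, ∃ e : ℕ, ρ^[e] m = 0

/-- The Hartshorne-Speiser-Lyubeznik number of a module with Frobenius action `ρ`: the least `e`
such that `ρ ^ e` kills every element killed by some iterate of `ρ` (`⊤` if there is none). -/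
def HSL (ρ : M →ₛₗ[frob p A] M) : ℕ∞ :=
  ⨅ (e : ℕ) (_ : ∀ m : M, (∃ k : ℕ, ρ^[k] m = 0) → ρ^[e] m = 0), (e : ℕ∞)

end Action

/-! ### Local cohomology through the Čech complex, with its Frobenius action -/

section Cech

variable {A : Type*} [CommRing A] {n : ℕ} (x : Fin n → A)

/-- The localization of `A` at the product `x_T` of the `x_k`, `k ∈ T`. -/
abbrev CechLoc (T : Finset (Fin n)) : Type _ :=
  Localization.Away (∏ k ∈ T, x k)

/-- The canonical map `A_f → A_g` when `f` divides `g`. -/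
def awayRes {f g : A} (h : f ∣ g) : Localization.Away f →ₐ[A] Localization.Away g :=
  IsLocalization.liftAlgHom (M := Submonoid.powers f)
    (f := Algebra.ofId A (Localization.Away g)) (by
      rintro ⟨_, m, rfl⟩
      rw [map_pow]
      exact ((isUnit_of_dvd_unit (map_dvd (Algebra.ofId A (Localization.Away g)) h)
        (IsLocalization.Away.algebraMap_isUnit g)).pow m))

/-- The degree `j` term `∏_{|T| = j} A_{x_T}` of the Čech complex; it is `A` in degree `0` and
zero in degrees outside `[0, n]`. -/
abbrev Cech (j : ℤ) : Type _ :=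
  ∀ T : {T : Finset (Fin n) // (T.card : ℤ) = j}, CechLoc x T.1

/-- The Čech differential
`(d c)_T = ∑_{k ∈ T} (-1)^{#{l ∈ T | l < k}} c_{T \ k}|_{A_{x_T}}`
from degree `i` to degree `j`; it is zero unless `j = i + 1`. -/
def cechD (i j : ℤ) : Cech x i →ₗ[A] Cech x j :=
  LinearMap.pi fun T => ∑ k : {k // k ∈ T.1},
    ((-1 : ℤ) ^ (T.1.filter (fun l => l < k.1)).card) •
      (if h : ((T.1.erase k.1).card : ℤ) = i then
        (awayRes (Finset.prod_dvd_prod_of_subset _ _ x (T.1.erase_subset k.1))).toLinearMap ∘ₗ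
          LinearMap.proj (⟨T.1.erase k.1, h⟩ : {T : Finset (Fin n) // (T.card : ℤ) = i})
      else 0)

variable (p : ℕ) [Fact p.Prime] [Algebra (ZMod p) A]

/-- The Frobenius of the Čech complex: the Frobenius endomorphism of each localization. -/
def cechFrob (j : ℤ) : Cech x j →ₛₗ[frob p A] Cech x j where
  toFun c := fun T => frob p (CechLoc x T.1) (c T)
  map_add' c c' := by ext T; exact map_add _ _ _
  map_smul' a c := by
    ext T
    change (a • c T) ^ p = a ^ p • (c T) ^ p
    rw [smul_pow]

lemma cechD_cechFrob (i j : ℤ) (c : Cech x i) :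
    cechD x i j (cechFrob x p i c) = cechFrob x p j (cechD x i j c) := by
  ext T
  change _ = frob p (CechLoc x T.1) _
  simp only [cechD, LinearMap.pi_apply, LinearMap.sum_apply, LinearMap.smul_apply, map_sum,
    map_zsmul]
  refine Finset.sum_congr rfl fun k _ => ?_
  congr 1
  split_ifs with h
  · exact map_pow (awayRes (Finset.prod_dvd_prod_of_subset _ _ x (T.1.erase_subset k.1))) _ _
  · simp

/-- Čech cohomology in degree `j`: cocycles modulo coboundaries. -/
abbrev CechH (j : ℤ) : Type _ :=
  LinearMap.ker (cechD x j (j + 1)) ⧸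
    (LinearMap.range (cechD x (j - 1) j)).submoduleOf (LinearMap.ker (cechD x j (j + 1)))

/-- The Frobenius action on Čech cocycles. -/
def cocycleFrob (j : ℤ) :
    LinearMap.ker (cechD x j (j + 1)) →ₛₗ[frob p A] LinearMap.ker (cechD x j (j + 1)) where
  toFun c := ⟨cechFrob x p j c.1, by
    rw [LinearMap.mem_ker, cechD_cechFrob, LinearMap.mem_ker.1 c.2, map_zero]⟩
  map_add' c c' := Subtype.ext (map_add _ _ _)
  map_smul' a c := Subtype.ext (map_smulₛₗ (cechFrob x p j) a c.1)

/-- The Frobenius action on Čech cohomology. -/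
def cohFrob (j : ℤ) : CechH x j →ₛₗ[frob p A] CechH x j :=
  Submodule.mapQ _ _ (cocycleFrob x p j) (by
    rintro c ⟨b, hb⟩
    exact ⟨cechFrob x p (j - 1) b, by
      rw [cechD_cechFrob, hb]; rfl⟩)

end Cech

section LocalCohomology

variable {A : Type*} [CommRing A] [IsNoetherianRing A]

lemma exists_generators (I : Ideal A) :
    ∃ (n : ℕ) (x : Fin n → A), Ideal.span (Set.range x) = I :=
  Submodule.fg_iff_exists_fin_generating_family.1 (IsNoetherian.noetherian I)

/-- The length of a chosen finite generating sequence of `I`. -/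
def numGens (I : Ideal A) : ℕ := (exists_generators I).choose

/-- A chosen finite generating sequence of `I`. -/
def gens (I : Ideal A) : Fin (numGens I) → A := (exists_generators I).choose_spec.choose

lemma span_gens (I : Ideal A) : Ideal.span (Set.range (gens I)) = I :=
  (exists_generators I).choose_spec.choose_spec

/-- The local cohomology module `H^j_I(A)` of a noetherian ring, as the cohomology of the Čech
complex on generators of `I`.  Up to an isomorphism compatible with the Frobenius actions it does
not depend on the generators.  It is zero for `j < 0`. -/
abbrev LocalCoh (I : Ideal A) (j : ℤ) : Type _ := CechH (gens I) j

variable (p : ℕ) [Fact p.Prime] [Algebra (ZMod p) A]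

/-- The canonical Frobenius action on `H^j_I(A)`. -/
def locFrob (I : Ideal A) (j : ℤ) : LocalCoh I j →ₛₗ[frob p A] LocalCoh I j :=
  cohFrob (gens I) p j

/-- `HSL H^j_I(A)`. -/
def hslLC (I : Ideal A) (j : ℤ) : ℕ∞ := HSL (locFrob p I j)

/-- The `F`-depth of a noetherian local ring `A` with maximal ideal `𝔫`: the least `j` such that
`H^j_𝔫(A)` is not nilpotent (`⊤` if there is none). -/
def fDepth (𝔫 : Ideal A) : ℕ∞ :=
  ⨅ (j : ℕ) (_ : ¬ IsNilpotentAction (locFrob p 𝔫 (j : ℤ))), (j : ℕ∞)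

/-- A noetherian local ring `A` with maximal ideal `𝔫` is weakly `F`-nilpotent if `H^j_𝔫(A)` is
nilpotent for all `j < dim A`. -/
def IsWeaklyFNilpotent (𝔫 : Ideal A) : Prop :=
  ∀ j : ℕ, (j : WithBot ℕ∞) < ringKrullDim A → IsNilpotentAction (locFrob p 𝔫 (j : ℤ))

end LocalCohomology

/-- The maximal ideal `𝔪 (R/𝔞)` of the quotient `R/𝔞` of a local ring `(R, 𝔪)` by a proper
ideal. -/
def quotMax {R : Type*} [CommRing R] [IsLocalRing R] (𝔞 : Ideal R) : Ideal (R ⧸ 𝔞) :=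
  (IsLocalRing.maximalIdeal R).map (Ideal.Quotient.mk 𝔞)

end FrobeniusGluing

end

noncomputable section

namespace FrobeniusGluing

/-! ### Cube complexes

A cube complex interpolates between Koszul and Čech complexes: an index `k` contributes the
localization at `a k` and the weight `w k`. -/

section Cube

variable {A : Type*} [CommRing A]

/-! Two ingredients are combined: a Mayer–Vietoris sequence with Frobenius, and a bound for
Frobenius test exponents of a weakly F-nilpotent local ring in terms of HSL numbers.

Since 𝔞₁ ∩ 𝔞₂ = 0, the ring R is the fibre product of R/𝔞₁ and R/𝔞₂ over R/𝔟, and this persists in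
every localization. The Čech complexes give an exact sequence H^{j-1}(R/𝔟) → H^j(R) → H^j(R/𝔞₁) ⊕
H^j(R/𝔞₂) compatible with Frobenius. A nilpotent class on R dies on the right after h_j steps, so it
then comes from a class of H^{j-1}(R/𝔟). That class is not nilpotent merely because its image is.
When H^{j-1}(R/𝔟) is nilpotent, which j ≤ F-depth R/𝔟 guarantees, another HSL H^{j-1}(R/𝔟) steps
kill it. This is (*); see `IsGluing.exists_cocycle` and `IsGluing.cechBd`. The same sequence shows
that R is weakly F-nilpotent (`IsGluing.cechNil`).

For the test exponent, let x be a sequence of d elements generating an 𝔪-primary ideal and y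
generators of 𝔪. The Koszul complex of x on A has top cohomology A/(x), and Frobenius maps it to
A/(x^p), the top cohomology for the p-th powers of x. Tensor it with the Čech complex of y. As y
lies in the radical of (x), the tensor product still computes Koszul cohomology
(`cubeBd_iff_of_subset`). Building it instead from the Čech complex, each Koszul variable is a cone
and adds the bounds in degrees i and i - 1 (`cubeBd_insert`). After d variables Pascal's rule yields
∑ C(d,j) HSL H^j in degree d (`pow_mem_frobPow_of_cech`). A shorter parameter sequence is completed
by high powers of further parameters, which Krull's intersection theorem then removes
(`fte_le_sum`).

Koszul and Čech complexes are both cubes: a k = 1 gives a Koszul direction of weight w k, w k = 1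
gives a Čech direction. Frobenius raises the weights to the p-th power, so the invariants `CubeNil`
and `CubeBd` quantify over all levels w^{p^e}. -/

lemma awayRes_algebraMap {f g : A} (h : f ∣ g) (r : A) :
    awayRes h (algebraMap A (Localization.Away f) r) = algebraMap A (Localization.Away g) r :=
  (awayRes h).commutes r

lemma awayRes_awayRes {f g k : A} (h : f ∣ g) (h' : g ∣ k) (z : Localization.Away f) :
    awayRes h' (awayRes h z) = awayRes (h.trans h') z := by
  have := IsLocalization.algHom_subsingleton (R := A) (Submonoid.powers f)
    (S := Localization.Away f) (P := Localization.Away k)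
  exact DFunLike.congr_fun (Subsingleton.elim ((awayRes h').comp (awayRes h))
    (awayRes (h.trans h'))) z

lemma awayRes_self {f : A} (h : f ∣ f) (z : Localization.Away f) : awayRes h z = z := by
  have := IsLocalization.algHom_subsingleton (R := A) (Submonoid.powers f)
    (S := Localization.Away f) (P := Localization.Away f)
  exact DFunLike.congr_fun (Subsingleton.elim (awayRes h) (AlgHom.id _ _)) z

/-- After multiplication by a power of `a`, an element of `A_{f a}` comes from `A_f`. -/
lemma exists_awayRes_eq_pow_smul {f g a : A} (h : f ∣ g) (hg : g = f * a)
    (z : Localization.Away g) : ∃ N : ℕ, ∀ n, N ≤ n → ∃ y, awayRes h y = a ^ n • z := by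
  obtain ⟨m, r, hr⟩ := IsLocalization.Away.surj g z
  refine ⟨m, fun n hn => ?_⟩
  have hu : IsUnit (algebraMap A (Localization.Away f) f) :=
    IsLocalization.Away.algebraMap_isUnit f
  obtain ⟨v, hv⟩ := (hu.pow m)
  have hz : f ^ m • a ^ m • z = algebraMap A _ r := by
    rw [← hr, smul_smul, ← mul_pow, ← hg, Algebra.smul_def, map_pow, mul_comm]
  refine ⟨a ^ (n - m) • (↑v⁻¹ * algebraMap A _ r), ?_⟩
  have hw : f ^ m • awayRes h (↑v⁻¹ * algebraMap A _ r) = f ^ m • a ^ m • z := by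
    rw [hz, ← map_smul, Algebra.smul_def, map_pow, ← hv, ← mul_assoc, Units.mul_inv, one_mul,
      awayRes_algebraMap]
  have hfu : IsUnit (algebraMap A (Localization.Away g) (f ^ m)) := by
    rw [map_pow]
    exact (isUnit_of_dvd_unit (map_dvd _ h) (IsLocalization.Away.algebraMap_isUnit g)).pow m
  rw [Algebra.smul_def, Algebra.smul_def (f ^ m) (a ^ m • z)] at hw
  rw [map_smul, hfu.mul_left_cancel hw, smul_smul, ← pow_add, Nat.sub_add_cancel hn]

/-- A numerator of z is killed by a power of f a, and f is a unit in A_f. The bound is uniform in n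
so that finitely many components can be treated with one exponent. -/
lemma exists_pow_smul_eq_zero {f g a : A} (h : f ∣ g) (hg : g = f * a)
    (z : Localization.Away f) (hz : awayRes h z = 0) :
    ∃ N : ℕ, ∀ n, N ≤ n → a ^ n • z = 0 := by
  obtain ⟨m, r, hr⟩ := IsLocalization.Away.surj f z
  have h0 : algebraMap A (Localization.Away g) r = 0 := by
    rw [← awayRes_algebraMap h, ← hr, map_mul, hz, zero_mul]
  obtain ⟨⟨_, N, rfl⟩, hN⟩ := (IsLocalization.map_eq_zero_iff (Submonoid.powers g) _ r).1 h0
  refine ⟨N, fun n hn => ?_⟩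
  have hu : IsUnit (algebraMap A (Localization.Away f) f) :=
    IsLocalization.Away.algebraMap_isUnit f
  refine (hu.pow (m + N)).mul_left_cancel ?_
  have h1 : algebraMap A (Localization.Away f) (g ^ N * r) = 0 := by
    simp only at hN
    rw [hN, map_zero]
  rw [hg, mul_pow, map_mul, map_mul] at h1
  rw [mul_zero, Algebra.smul_def]
  obtain ⟨t, rfl⟩ := Nat.exists_eq_add_of_le hn
  simp only [map_pow, map_mul, pow_add] at hr h1 ⊢
  linear_combination
    (algebraMap A (Localization.Away f) a) ^ t * h1 +
    (algebraMap A (Localization.Away f) f) ^ N * (algebraMap A (Localization.Away f) a) ^ N *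
    (algebraMap A (Localization.Away f) a) ^ t * hr

variable {N : ℕ} (a : Fin N → A)

/-- Cochains of the full cube. -/
abbrev Cube : Type _ := ∀ T : Finset (Fin N), CechLoc a T

/-- The restriction map of the cube along an inclusion of index sets. -/
def cubeRes {S T : Finset (Fin N)} (h : S ⊆ T) : CechLoc a S →ₐ[A] CechLoc a T :=
  awayRes (Finset.prod_dvd_prod_of_subset _ _ a h)

lemma cubeRes_cubeRes {S T U : Finset (Fin N)} (h : S ⊆ T) (h' : T ⊆ U) (z : CechLoc a S) :
    cubeRes a h' (cubeRes a h z) = cubeRes a (h.trans h') z := awayRes_awayRes _ _ z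

lemma cubeRes_congr (c : Cube a) {S S' T : Finset (Fin N)} (e : S = S') (h : S ⊆ T)
    (h' : S' ⊆ T) : cubeRes a h (c S) = cubeRes a h' (c S') := by
  subst e; rfl

/-- The sign of the index `k` in the set `T`. -/
def cubeSign (A : Type*) [CommRing A] {N : ℕ} (k : Fin N) (T : Finset (Fin N)) : A :=
  (-1) ^ (T.filter (fun l => l < k)).card

lemma cubeSign_mul_self (k : Fin N) (T : Finset (Fin N)) : cubeSign A k T * cubeSign A k T = 1 := by
  rw [cubeSign, ← mul_pow]; simp

lemma cubeSign_erase_of_le {j k : Fin N} (h : j ≤ k) (T : Finset (Fin N)) :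
    cubeSign A j (T.erase k) = cubeSign A j T := by
  unfold cubeSign
  congr 2
  ext l
  simp only [Finset.mem_filter, Finset.mem_erase]
  constructor
  · rintro ⟨⟨-, h1⟩, h2⟩; exact ⟨h1, h2⟩
  · rintro ⟨h1, h2⟩; exact ⟨⟨(h2.trans_le h).ne, h1⟩, h2⟩

lemma cubeSign_erase_of_lt {j k : Fin N} (h : j < k) {T : Finset (Fin N)} (hj : j ∈ T) :
    cubeSign A k (T.erase j) = - cubeSign A k T := by
  unfold cubeSign
  have : T.filter (fun l => l < k) = insert j ((T.erase j).filter (fun l => l < k)) := by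
    ext l
    simp only [Finset.mem_filter, Finset.mem_erase, Finset.mem_insert]
    by_cases hl : l = j
    · subst hl; simp [hj, h]
    · simp [hl]
  rw [this, Finset.card_insert_of_notMem (by simp), pow_succ]
  ring

/-- The part of the cube differential in the direction `k`. -/
def wedge (k : Fin N) : Cube a →ₗ[A] Cube a :=
  LinearMap.pi fun T => if k ∈ T then
    cubeSign A k T • (cubeRes a (T.erase_subset k)).toLinearMap ∘ₗ LinearMap.proj (T.erase k) else 0

variable {a}

lemma wedge_apply_of_mem {k : Fin N} {T : Finset (Fin N)} (h : k ∈ T) (c : Cube a) :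
    wedge a k c T = cubeSign A k T • cubeRes a (T.erase_subset k) (c (T.erase k)) := by
  simp only [wedge, LinearMap.pi_apply, if_pos h]; rfl

lemma wedge_apply_of_notMem {k : Fin N} {T : Finset (Fin N)} (h : k ∉ T) (c : Cube a) :
    wedge a k c T = 0 := by
  simp only [wedge, LinearMap.pi_apply, if_neg h]; rfl

lemma wedge_self (k : Fin N) (c : Cube a) : wedge a k (wedge a k c) = 0 := by
  ext T
  by_cases h : k ∈ T
  · rw [wedge_apply_of_mem h, wedge_apply_of_notMem (by simp), map_zero, smul_zero]; rfl
  · rw [wedge_apply_of_notMem h]; rfl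

lemma wedge_anticomm_of_lt {j k : Fin N} (hjk : j < k) (c : Cube a) :
    wedge a j (wedge a k c) = - wedge a k (wedge a j c) := by
  ext T
  rw [Pi.neg_apply]
  by_cases hj : j ∈ T
  · by_cases hk : k ∈ T
    · rw [wedge_apply_of_mem hj, wedge_apply_of_mem hk,
        wedge_apply_of_mem (Finset.mem_erase.2 ⟨hjk.ne', hk⟩),
        wedge_apply_of_mem (Finset.mem_erase.2 ⟨hjk.ne, hj⟩), map_smul, map_smul,
        cubeSign_erase_of_lt hjk hj, cubeSign_erase_of_le hjk.le, cubeRes_cubeRes,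
        cubeRes_cubeRes, smul_smul, smul_smul,
        cubeRes_congr a c (Finset.erase_right_comm (s := T) (a := j) (b := k)) _
          ((Finset.erase_subset _ _).trans (Finset.erase_subset _ _)), mul_neg, neg_smul,
        mul_comm (cubeSign A j T)]
    · rw [wedge_apply_of_mem hj, wedge_apply_of_notMem hk,
        wedge_apply_of_notMem (fun h => hk (Finset.mem_of_mem_erase h)), map_zero, smul_zero,
        neg_zero]
  · by_cases hk : k ∈ T
    · rw [wedge_apply_of_mem hk, wedge_apply_of_notMem hj,
        wedge_apply_of_notMem (fun h => hj (Finset.mem_of_mem_erase h)), map_zero, smul_zero,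
        neg_zero]
    · rw [wedge_apply_of_notMem hj, wedge_apply_of_notMem hk, neg_zero]

/-- Together with `wedge_self` this makes any weighted sum of these operators square to zero,
whatever the weights. -/
lemma wedge_anticomm (j k : Fin N) (c : Cube a) :
    wedge a j (wedge a k c) = - wedge a k (wedge a j c) := by
  rcases lt_trichotomy j k with h | h | h
  · exact wedge_anticomm_of_lt h c
  · subst h; rw [wedge_self, neg_zero]
  · rw [wedge_anticomm_of_lt h, neg_neg]

/-- The submodule of cochains of degree `i` supported on the interval `[S₀, S]` of index sets. -/
def cubeSupp (a : Fin N → A) (S₀ S : Finset (Fin N)) (i : ℤ) : Submodule A (Cube a) where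
  carrier := {c | ∀ T, c T ≠ 0 → S₀ ⊆ T ∧ T ⊆ S ∧ (T.card : ℤ) = i}
  zero_mem' := fun T h => absurd rfl h
  add_mem' := by
    intro c c' hc hc' T hT
    by_cases h : c T = 0
    · exact hc' T (fun h' => hT (by rw [Pi.add_apply, h, h', add_zero]))
    · exact hc T h
  smul_mem' := by
    intro r c hc T hT
    exact hc T (fun h' => hT (by rw [Pi.smul_apply, h', smul_zero]))

lemma cubeSupp_mono {S₀ S₀' S S' : Finset (Fin N)} (h₀ : S₀ ⊆ S₀') (h : S' ⊆ S) {i : ℤ}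
    {c : Cube a} (hc : c ∈ cubeSupp a S₀' S' i) : c ∈ cubeSupp a S₀ S i := fun T hT =>
  ⟨h₀.trans (hc T hT).1, (hc T hT).2.1.trans h, (hc T hT).2.2⟩

lemma wedge_mem_cubeSupp {S₀ S : Finset (Fin N)} {i : ℤ} {k : Fin N} {c : Cube a}
    (hc : c ∈ cubeSupp a S₀ S i) :
    wedge a k c ∈ cubeSupp a (insert k S₀) (insert k S) (i + 1) := by
  intro T hT
  have hk : k ∈ T := by
    by_contra h
    exact hT (wedge_apply_of_notMem h c)
  have h0 : c (T.erase k) ≠ 0 := by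
    intro h
    exact hT (by rw [wedge_apply_of_mem hk, h, map_zero, smul_zero])
  obtain ⟨h1, h2, h3⟩ := hc _ h0
  rw [← Finset.insert_erase hk]
  refine ⟨Finset.insert_subset_insert _ h1, Finset.insert_subset_insert _ h2, ?_⟩
  rw [Finset.card_insert_of_notMem (by simp)]
  push_cast
  rw [h3]

lemma wedge_eq_zero_of_mem_cubeSupp {S₀ S : Finset (Fin N)} {i : ℤ} {k : Fin N} {c : Cube a}
    (hk : k ∈ S₀) (hc : c ∈ cubeSupp a S₀ S i) : wedge a k c = 0 := by
  ext T
  by_cases h : k ∈ T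
  · rw [wedge_apply_of_mem h]
    by_cases h0 : c (T.erase k) = 0
    · rw [h0, map_zero, smul_zero]; rfl
    · exact absurd ((hc _ h0).1 hk) (by simp)
  · rw [wedge_apply_of_notMem h]; rfl

end Cube

/-! ### The differential of a cube, truncation, and exactness from radical conditions. -/

section CubeDifferential

variable {A : Type*} [CommRing A] {N : ℕ} {a : Fin N → A}

lemma wedge_apply_insert {k : Fin N} {U : Finset (Fin N)} (hk : k ∉ U) (c : Cube a) :
    wedge a k c (insert k U) =
      cubeSign A k (insert k U) • cubeRes a (Finset.subset_insert k U) (c U) := by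
  rw [wedge_apply_of_mem (Finset.mem_insert_self k U)]
  congr 1
  exact cubeRes_congr a c (Finset.erase_insert hk) _ _

variable (a) in
/-- The differential of the cube with weights `w` on the index set `S`. -/
def cubeD (w : Fin N → A) (S : Finset (Fin N)) : Cube a →ₗ[A] Cube a :=
  ∑ k ∈ S, w k • wedge a k

variable {w : Fin N → A} {S₀ S : Finset (Fin N)} {i : ℤ} {k : Fin N}

lemma cubeD_apply (c : Cube a) : cubeD a w S c = ∑ k ∈ S, w k • wedge a k c := by
  simp [cubeD, LinearMap.sum_apply]

lemma cubeD_insert (hk : k ∉ S) (c : Cube a) :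
    cubeD a w (insert k S) c = w k • wedge a k c + cubeD a w S c := by
  rw [cubeD_apply, cubeD_apply, Finset.sum_insert hk]

lemma wedge_cubeD (c : Cube a) : wedge a k (cubeD a w S c) = - cubeD a w S (wedge a k c) := by
  rw [cubeD_apply, cubeD_apply, map_sum, ← Finset.sum_neg_distrib]
  refine Finset.sum_congr rfl fun j _ => ?_
  rw [map_smul, wedge_anticomm, smul_neg]

lemma cubeD_cubeD (c : Cube a) : cubeD a w S (cubeD a w S c) = 0 := by
  induction S using Finset.induction_on with
  | empty => simp [cubeD]
  | insert k S hk ih =>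
    rw [cubeD_insert hk, cubeD_insert hk c, map_add, map_add, map_smul, map_smul, wedge_self, ih,
      wedge_cubeD]
    simp

lemma cubeD_mem_cubeSupp {c : Cube a} (hc : c ∈ cubeSupp a S₀ S i) :
    cubeD a w S c ∈ cubeSupp a S₀ S (i + 1) := by
  rw [cubeD_apply]
  refine Submodule.sum_mem _ fun k hk => Submodule.smul_mem _ _ ?_
  have := wedge_mem_cubeSupp (k := k) hc
  rw [Finset.insert_eq_of_mem hk] at this
  exact cubeSupp_mono (Finset.subset_insert _ _) le_rfl this

lemma cubeD_insert_of_mem_cubeSupp (hk : k ∉ S) {S' : Finset (Fin N)} {c : Cube a}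
    (hc : c ∈ cubeSupp a (insert k S₀) S' i) :
    cubeD a w (insert k S) c = cubeD a w S c := by
  rw [cubeD_insert hk, wedge_eq_zero_of_mem_cubeSupp (Finset.mem_insert_self _ _) hc, smul_zero,
    zero_add]

variable (a) in
/-- Truncation of cochains to the subsets of `S`. -/
def cubeTrunc (S : Finset (Fin N)) : Cube a →ₗ[A] Cube a where
  toFun c := fun T => if T ⊆ S then c T else 0
  map_add' c c' := by ext T; by_cases h : T ⊆ S <;> simp [h]
  map_smul' r c := by ext T; by_cases h : T ⊆ S <;> simp [h]

lemma cubeTrunc_apply_of_subset {T : Finset (Fin N)} (h : T ⊆ S) (c : Cube a) :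
    cubeTrunc a S c T = c T := if_pos h

lemma cubeTrunc_apply_of_not_subset {T : Finset (Fin N)} (h : ¬ T ⊆ S) (c : Cube a) :
    cubeTrunc a S c T = 0 := if_neg h

lemma cubeTrunc_of_mem {c : Cube a} (hc : c ∈ cubeSupp a S₀ S i) : cubeTrunc a S c = c := by
  ext T
  by_cases h : T ⊆ S
  · exact cubeTrunc_apply_of_subset h c
  · rw [cubeTrunc_apply_of_not_subset h]
    by_contra h0
    exact h (hc T (Ne.symm h0)).2.1

lemma cubeTrunc_mem {S' : Finset (Fin N)} {c : Cube a} (hc : c ∈ cubeSupp a S₀ S' i) :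
    cubeTrunc a S c ∈ cubeSupp a S₀ S i := by
  intro T hT
  by_cases h : T ⊆ S
  · rw [cubeTrunc_apply_of_subset h] at hT
    exact ⟨(hc T hT).1, h, (hc T hT).2.2⟩
  · exact absurd (cubeTrunc_apply_of_not_subset h c) hT

/-- The kernel of truncation from insert k S to S consists of the cochains through k. This is the
subcomplex in the cone sequence used throughout. -/
lemma sub_cubeTrunc_mem {c : Cube a} (hc : c ∈ cubeSupp a S₀ (insert k S) i) :
    c - cubeTrunc a S c ∈ cubeSupp a (insert k S₀) (insert k S) i := by
  intro T hT
  rw [Pi.sub_apply] at hT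
  by_cases h : T ⊆ S
  · rw [cubeTrunc_apply_of_subset h, sub_self] at hT
    exact absurd rfl hT
  · rw [cubeTrunc_apply_of_not_subset h, sub_zero] at hT
    obtain ⟨h1, h2, h3⟩ := hc T hT
    refine ⟨Finset.insert_subset ?_ h1, h2, h3⟩
    by_contra hk
    exact h ((Finset.subset_insert_iff_of_notMem hk).1 h2)

lemma cubeTrunc_wedge_of_mem (hk : k ∈ S) (c : Cube a) :
    cubeTrunc a S (wedge a k c) = wedge a k (cubeTrunc a S c) := by
  ext T
  by_cases h : k ∈ T
  · rw [wedge_apply_of_mem h]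
    by_cases hT : T ⊆ S
    · rw [cubeTrunc_apply_of_subset hT, wedge_apply_of_mem h,
        cubeTrunc_apply_of_subset ((Finset.erase_subset _ _).trans hT)]
    · rw [cubeTrunc_apply_of_not_subset hT, cubeTrunc_apply_of_not_subset, map_zero, smul_zero]
      intro h'
      apply hT
      rw [← Finset.insert_erase h]
      exact Finset.insert_subset hk h'
  · rw [wedge_apply_of_notMem h]
    by_cases hT : T ⊆ S
    · rw [cubeTrunc_apply_of_subset hT, wedge_apply_of_notMem h]
    · rw [cubeTrunc_apply_of_not_subset hT]

lemma cubeTrunc_wedge_of_notMem (hk : k ∉ S) (c : Cube a) :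
    cubeTrunc a S (wedge a k c) = 0 := by
  ext T
  by_cases hT : T ⊆ S
  · rw [cubeTrunc_apply_of_subset hT, wedge_apply_of_notMem (fun h => hk (hT h))]; rfl
  · rw [cubeTrunc_apply_of_not_subset hT]; rfl

lemma cubeTrunc_cubeD {S' : Finset (Fin N)} (h : S ⊆ S') (c : Cube a) :
    cubeTrunc a S (cubeD a w S' c) = cubeD a w S (cubeTrunc a S c) := by
  rw [cubeD_apply, cubeD_apply, map_sum, ← Finset.sum_subset h]
  · refine Finset.sum_congr rfl fun k hk => ?_
    rw [map_smul, cubeTrunc_wedge_of_mem hk]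
  · intro k _ hk
    rw [map_smul, cubeTrunc_wedge_of_notMem hk, smul_zero]

/-- Up to sign, the k-direction map is localization at a k in each component, so its cokernel is a
k-power torsion. For a k = 1 it is onto, which is how the Koszul case uses it. -/
lemma exists_wedge_eq_pow_smul (hk₀ : k ∉ S₀) {c : Cube a}
    (hc : c ∈ cubeSupp a (insert k S₀) (insert k S) i) :
    ∃ n : ℕ, ∃ b ∈ cubeSupp a S₀ S (i - 1), wedge a k b = a k ^ n • c := by
  classical
  have key : ∀ U : Finset (Fin N), ∃ n : ℕ, ∀ m, n ≤ m → k ∉ U →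
      ∃ y, cubeRes a (Finset.subset_insert k U) y =
        a k ^ m • (cubeSign A k (insert k U) • c (insert k U)) := by
    intro U
    by_cases hU : k ∈ U
    · exact ⟨0, fun m _ h => absurd hU h⟩
    · obtain ⟨n, hn⟩ := exists_awayRes_eq_pow_smul
        (Finset.prod_dvd_prod_of_subset _ _ a (Finset.subset_insert k U))
        (by rw [Finset.prod_insert hU, mul_comm])
        (cubeSign A k (insert k U) • c (insert k U))
      exact ⟨n, fun m hm _ => hn m hm⟩
  choose n hn using key
  let M := Finset.univ.sup n
  have key' : ∀ U : Finset (Fin N), k ∉ U → ∃ y, cubeRes a (Finset.subset_insert k U) y =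
        a k ^ M • (cubeSign A k (insert k U) • c (insert k U)) := fun U hU =>
    hn U M (Finset.le_sup (Finset.mem_univ U)) hU
  choose y hy using key'
  refine ⟨M, fun U => if h : k ∉ U ∧ c (insert k U) ≠ 0 then y U h.1 else 0, ?_, ?_⟩
  · intro U hU
    by_cases h : k ∉ U ∧ c (insert k U) ≠ 0
    · obtain ⟨h1, h2, h3⟩ := hc _ h.2
      rw [Finset.card_insert_of_notMem h.1] at h3
      push_cast at h3
      refine ⟨fun l hl => ?_, (Finset.insert_subset_insert_iff h.1).1 h2, by omega⟩
      exact Finset.mem_of_mem_insert_of_ne (h1 (Finset.mem_insert_of_mem hl))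
        (fun e => hk₀ (e ▸ hl))
    · exact absurd (dif_neg h) hU
  · ext T
    by_cases hT : k ∈ T
    · obtain ⟨U, hU, rfl⟩ : ∃ U, k ∉ U ∧ insert k U = T :=
        ⟨T.erase k, by simp, Finset.insert_erase hT⟩
      rw [wedge_apply_insert hU, Pi.smul_apply]
      by_cases h : c (insert k U) = 0
      · rw [dif_neg (fun h' => h'.2 h), map_zero, smul_zero, h, smul_zero]
      · rw [dif_pos ⟨hU, h⟩, hy, smul_comm, smul_smul (cubeSign A k _), cubeSign_mul_self,
          one_smul]
    · rw [wedge_apply_of_notMem hT, Pi.smul_apply]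
      by_cases h : c T = 0
      · rw [h, smul_zero]
      · exact absurd ((hc T h).1 (Finset.mem_insert_self _ _)) hT

/-- The kernel counterpart: elements killed by localization at a k are a k-power torsion. -/
lemma exists_pow_smul_eq_zero_of_wedge (hk : k ∉ S) {c : Cube a}
    (hc : c ∈ cubeSupp a S₀ S i) (h : wedge a k c = 0) : ∃ n : ℕ, a k ^ n • c = 0 := by
  classical
  have key : ∀ U : Finset (Fin N), ∃ n : ℕ, ∀ m, n ≤ m → a k ^ m • c U = 0 := by
    intro U
    by_cases hU : k ∈ U
    · refine ⟨0, fun m _ => ?_⟩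
      by_cases h0 : c U = 0
      · rw [h0, smul_zero]
      · exact absurd ((hc U h0).2.1 hU) hk
    · refine exists_pow_smul_eq_zero
        (Finset.prod_dvd_prod_of_subset _ _ a (Finset.subset_insert k U))
        (by rw [Finset.prod_insert hU, mul_comm]) (c U) ?_
      have h1 := congr_fun h (insert k U)
      rw [wedge_apply_insert hU] at h1
      have h2 := congr_arg (fun z => cubeSign A k (insert k U) • z) h1
      simp only [smul_smul, cubeSign_mul_self, one_smul, Pi.zero_apply, smul_zero] at h2
      exact h2
  choose n hn using key
  exact ⟨Finset.univ.sup n, funext fun U => hn U _ (Finset.le_sup (Finset.mem_univ U))⟩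

variable (a) in
/-- The coboundaries of degree `i` of the cube on the interval `[S₀, S]`. -/
def cubeCob (w : Fin N → A) (S₀ S : Finset (Fin N)) (i : ℤ) : Submodule A (Cube a) :=
  (cubeSupp a S₀ S (i - 1)).map (cubeD a w S)

lemma cubeCob_le : cubeCob a w S₀ S i ≤ cubeSupp a S₀ S i := by
  rintro _ ⟨b, hb, rfl⟩
  have := cubeD_mem_cubeSupp (w := w) hb
  rwa [sub_add_cancel] at this

/-- The cube is the cone of w k times localization at a k. Modulo powers of a k w k this map is
invertible, so the product acts locally nilpotently on cohomology. Concretely, a coboundary removes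
the part through k, and the rest is annihilated by w k up to a k-power torsion. -/
lemma exists_pow_smul_mem_cubeCob (hk₀ : k ∉ S₀) (hk : k ∈ S) {c : Cube a}
    (hc : c ∈ cubeSupp a S₀ S i) (hd : cubeD a w S c = 0) :
    ∃ n : ℕ, (a k * w k) ^ n • c ∈ cubeCob a w S₀ S i := by
  obtain ⟨S, hkS, rfl⟩ : ∃ S', k ∉ S' ∧ insert k S' = S :=
    ⟨S.erase k, by simp, Finset.insert_erase hk⟩
  obtain ⟨M, b, hb, hbc⟩ := exists_wedge_eq_pow_smul hk₀ (sub_cubeTrunc_mem hc)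
  -- The factor is chosen so that w k times the k-direction of b' is exactly (a k * w k) ^ (M + 1)
  -- times the part of c through k.
  let b' := (w k ^ M * a k) • b
  have hb' : b' ∈ cubeSupp a S₀ S (i - 1) := Submodule.smul_mem _ _ hb
  let f := (a k * w k) ^ (M + 1) • c - cubeD a w (insert k S) b'
  have hf : f = (a k * w k) ^ (M + 1) • cubeTrunc a S c - cubeD a w S b' := by
    simp only [f, b']
    rw [cubeD_insert hkS, map_smul (wedge a k), hbc, smul_smul, smul_smul,
      show w k * (w k ^ M * a k) * a k ^ M = (a k * w k) ^ (M + 1) by ring, smul_sub]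
    abel
  have hfS : f ∈ cubeSupp a S₀ S i := by
    rw [hf]
    have := cubeD_mem_cubeSupp (w := w) hb'
    rw [sub_add_cancel] at this
    exact Submodule.sub_mem _ (Submodule.smul_mem _ _ (cubeTrunc_mem hc)) this
  have hDf : cubeD a w (insert k S) f = 0 := by
    simp only [f]
    rw [map_sub, map_smul, hd, cubeD_cubeD, smul_zero, sub_zero]
  have hDf0 : cubeD a w S f = 0 := by
    have := cubeTrunc_cubeD (w := w) (Finset.subset_insert k S) f
    rw [hDf, map_zero, cubeTrunc_of_mem hfS] at this
    exact this.symm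
  have hwf : wedge a k (w k • f) = 0 := by
    rw [cubeD_insert hkS, hDf0, add_zero] at hDf
    rw [map_smul, hDf]
  obtain ⟨n, hn⟩ := exists_pow_smul_eq_zero_of_wedge hkS (Submodule.smul_mem _ _ hfS) hwf
  refine ⟨n + 1 + (M + 1), (a k * w k) ^ (n + 1) • b', Submodule.smul_mem _ _
    (cubeSupp_mono le_rfl (Finset.subset_insert _ _) hb'), ?_⟩
  have h0 : (a k * w k) ^ (n + 1) • f = 0 := by
    rw [show (a k * w k) ^ (n + 1) = (a k * w k ^ n) * (a k ^ n * w k) by ring, mul_smul,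
      mul_smul (a k ^ n), hn, smul_zero]
  simp only [f] at h0
  rw [smul_sub, sub_eq_zero, smul_smul, ← pow_add] at h0
  rw [map_smul, h0]

/-- The annihilator of the class of c is an ideal whose radical contains each generator a k * w k,
hence the whole radical. -/
lemma exists_pow_smul_mem_cubeCob_of_radical {z : A}
    (hz : z ∈ (Ideal.span ((fun k => a k * w k) '' ((S : Set (Fin N)) \ S₀))).radical)
    {c : Cube a} (hc : c ∈ cubeSupp a S₀ S i) (hd : cubeD a w S c = 0) :
    ∃ n : ℕ, z ^ n • c ∈ cubeCob a w S₀ S i := by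
  let J : Ideal A := (cubeCob a w S₀ S i).comap (LinearMap.toSpanSingleton A (Cube a) c)
  have hJ : (Ideal.span ((fun k => a k * w k) '' ((S : Set (Fin N)) \ S₀))).radical ≤ J.radical := by
    rw [Ideal.radical_le_radical_iff, Ideal.span_le]
    rintro _ ⟨k, ⟨hk, hk₀⟩, rfl⟩
    exact exists_pow_smul_mem_cubeCob hk₀ hk hc hd
  exact hJ hz

/-- Components through k live in rings where a k is already inverted, so a k acts bijectively on
such cochains; injectivity is `eq_zero_of_smul_eq_zero_of_mem_cubeSupp`. -/
lemma exists_smul_eq_of_mem_cubeSupp (hk : k ∈ S₀) {c : Cube a}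
    (hc : c ∈ cubeSupp a S₀ S i) (n : ℕ) :
    ∃ c' ∈ cubeSupp a S₀ S i, a k ^ n • c' = c := by
  have key : ∀ T : Finset (Fin N), k ∈ T → ∃ y : CechLoc a T, a k ^ n • y = c T := by
    intro T hT
    have hu : IsUnit (algebraMap A (CechLoc a T) (a k)) :=
      isUnit_of_dvd_unit (map_dvd _ (Finset.dvd_prod_of_mem a hT))
        (IsLocalization.Away.algebraMap_isUnit (∏ k ∈ T, a k))
    obtain ⟨v, hv⟩ := hu.pow n
    refine ⟨↑v⁻¹ * c T, ?_⟩
    rw [Algebra.smul_def, map_pow, ← hv, ← mul_assoc, Units.mul_inv, one_mul]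
  choose y hy using key
  classical
  refine ⟨fun T => if h : k ∈ T ∧ c T ≠ 0 then y T h.1 else 0, ?_, ?_⟩
  · intro T hT
    by_cases h : k ∈ T ∧ c T ≠ 0
    · exact hc T h.2
    · exact absurd (dif_neg h) hT
  · ext T
    rw [Pi.smul_apply]
    by_cases h : c T = 0
    · rw [dif_neg (fun h' => h'.2 h), smul_zero, h]
    · have hT := (hc T h).1 hk
      rw [dif_pos ⟨hT, h⟩, hy]

lemma eq_zero_of_smul_eq_zero_of_mem_cubeSupp (hk : k ∈ S₀) {c : Cube a}
    (hc : c ∈ cubeSupp a S₀ S i) (n : ℕ) (h : a k ^ n • c = 0) : c = 0 := by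
  ext T
  by_contra h0
  have hT := (hc T h0).1 hk
  have hu : IsUnit (algebraMap A (CechLoc a T) (a k)) :=
    isUnit_of_dvd_unit (map_dvd _ (Finset.dvd_prod_of_mem a hT))
      (IsLocalization.Away.algebraMap_isUnit (∏ k ∈ T, a k))
  have h1 := congr_fun h T
  rw [Pi.smul_apply, Algebra.smul_def, map_pow] at h1
  exact h0 ((hu.pow n).mul_right_eq_zero.1 h1)

/-- If `a k` is in the radical of the ideal of the other elements, the part of the cube with `k`
is exact. -/
lemma mem_cubeCob_insert (hk : k ∉ S)
    (hz : a k ∈ (Ideal.span ((fun k => a k * w k) '' (S : Set (Fin N)))).radical)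
    {c : Cube a} (hc : c ∈ cubeSupp a {k} (insert k S) i)
    (hd : cubeD a w (insert k S) c = 0) : c ∈ cubeCob a w {k} (insert k S) i := by
  -- A power of a k kills the class, while a k is invertible on the cochains through k; dividing the
  -- bounding cochain by that power gives exactness.
  obtain ⟨n, b, hb, hbc⟩ := exists_pow_smul_mem_cubeCob_of_radical (z := a k) (S₀ := {k})
    (by
      have : ((insert k S : Finset (Fin N)) : Set (Fin N)) \ ({k} : Finset (Fin N)) = S := by
        ext l
        by_cases hl : l = k <;> simp [hl, hk]
      rwa [this]) hc hd
  obtain ⟨b', hb', rfl⟩ := exists_smul_eq_of_mem_cubeSupp (Finset.mem_singleton_self k) hb n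
  refine ⟨b', hb', ?_⟩
  have hcob : cubeD a w (insert k S) b' - c ∈ cubeSupp a {k} (insert k S) i :=
    Submodule.sub_mem _ (cubeCob_le ⟨b', hb', rfl⟩) hc
  refine sub_eq_zero.1 (eq_zero_of_smul_eq_zero_of_mem_cubeSupp (Finset.mem_singleton_self k)
    hcob n ?_)
  rw [smul_sub, ← map_smul, hbc, sub_self]

/-- After subtracting the differential of a cochain bounding the truncation, what remains lies in
the subcomplex through k, which is exact. -/
lemma cubeCob_insert_of_cubeTrunc (hk : k ∉ S)
    (hz : a k ∈ (Ideal.span ((fun k => a k * w k) '' (S : Set (Fin N)))).radical)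
    {c : Cube a} (hc : c ∈ cubeSupp a ∅ (insert k S) i) (hd : cubeD a w (insert k S) c = 0)
    (h : cubeTrunc a S c ∈ cubeCob a w ∅ S i) : c ∈ cubeCob a w ∅ (insert k S) i := by
  obtain ⟨b, hb, hbc⟩ := h
  have hb' := cubeSupp_mono (le_refl ∅) (Finset.subset_insert k S) hb
  have hf : c - cubeD a w (insert k S) b ∈ cubeSupp a {k} (insert k S) i := by
    have h1 : c - cubeD a w (insert k S) b ∈ cubeSupp a ∅ (insert k S) i :=
      Submodule.sub_mem _ hc (cubeCob_le ⟨b, hb', rfl⟩)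
    have h2 := sub_cubeTrunc_mem h1
    rwa [map_sub, cubeTrunc_cubeD (Finset.subset_insert k S), cubeTrunc_of_mem hb, hbc, sub_self,
      sub_zero] at h2
  obtain ⟨b₁, hb₁, h₁⟩ := mem_cubeCob_insert hk hz hf (by rw [map_sub, hd, cubeD_cubeD, sub_zero])
  exact ⟨b + b₁, Submodule.add_mem _ hb' (cubeSupp_mono (Finset.empty_subset _) le_rfl hb₁),
    by rw [map_add, h₁, add_sub_cancel]⟩

/-- The obstruction to extending c is the cocycle w k times its k-direction. It lies in the exact
subcomplex through k, so c can be corrected there without changing its truncation. -/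
lemma exists_cocycle_insert (hk : k ∉ S)
    (hz : a k ∈ (Ideal.span ((fun k => a k * w k) '' (S : Set (Fin N)))).radical)
    {c : Cube a} (hc : c ∈ cubeSupp a ∅ S i) (hd : cubeD a w S c = 0) :
    ∃ c' ∈ cubeSupp a ∅ (insert k S) i, cubeD a w (insert k S) c' = 0 ∧ cubeTrunc a S c' = c := by
  have hs : w k • wedge a k c ∈ cubeSupp a {k} (insert k S) (i + 1) :=
    Submodule.smul_mem _ _ (wedge_mem_cubeSupp hc)
  obtain ⟨b, hb, hbc⟩ := mem_cubeCob_insert hk hz hs (by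
    rw [map_smul, cubeD_insert hk, wedge_self, ← neg_neg (cubeD a w S _), ← wedge_cubeD, hd]
    simp)
  rw [add_sub_cancel_right] at hb
  refine ⟨c - b, Submodule.sub_mem _ (cubeSupp_mono le_rfl (Finset.subset_insert k S) hc)
    (cubeSupp_mono (Finset.empty_subset _) le_rfl hb), ?_, ?_⟩
  · rw [map_sub, hbc, cubeD_insert hk, hd, add_zero, sub_self]
  · rw [map_sub, cubeTrunc_of_mem hc, sub_eq_self]
    ext T
    by_cases hT : T ⊆ S
    · rw [cubeTrunc_apply_of_subset hT]
      by_contra h0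
      exact hk (hT ((hb T h0).1 (Finset.mem_singleton_self k)))
    · rw [cubeTrunc_apply_of_not_subset hT]; rfl

lemma cubeTrunc_cubeTrunc {S' : Finset (Fin N)} (h : S ⊆ S') (c : Cube a) :
    cubeTrunc a S (cubeTrunc a S' c) = cubeTrunc a S c := by
  ext T
  by_cases hT : T ⊆ S
  · rw [cubeTrunc_apply_of_subset hT, cubeTrunc_apply_of_subset hT,
      cubeTrunc_apply_of_subset (hT.trans h)]
  · rw [cubeTrunc_apply_of_not_subset hT, cubeTrunc_apply_of_not_subset hT]

lemma span_image_radical_mono {S S' : Finset (Fin N)} (h : S ⊆ S') :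
    (Ideal.span ((fun k => a k * w k) '' (S : Set (Fin N)))).radical ≤
      (Ideal.span ((fun k => a k * w k) '' (S' : Set (Fin N)))).radical :=
  Ideal.radical_mono (Ideal.span_mono (Set.image_mono (by exact_mod_cast h)))

/-- Truncation to `S` is injective on cohomology if the other `a k` are in the radical. -/
lemma cubeCob_of_cubeTrunc {S' : Finset (Fin N)} (h : S ⊆ S')
    (hz : ∀ k ∈ S', k ∉ S →
      a k ∈ (Ideal.span ((fun k => a k * w k) '' (S : Set (Fin N)))).radical)
    {c : Cube a} (hc : c ∈ cubeSupp a ∅ S' i) (hd : cubeD a w S' c = 0)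
    (hb : cubeTrunc a S c ∈ cubeCob a w ∅ S i) : c ∈ cubeCob a w ∅ S' i := by
  obtain ⟨X, hX, rfl⟩ : ∃ X, Disjoint S X ∧ S ∪ X = S' :=
    ⟨S' \ S, Finset.disjoint_sdiff, Finset.union_sdiff_of_subset h⟩
  clear h
  induction X using Finset.induction_on generalizing c with
  | empty =>
    rw [Finset.union_empty] at hc hd ⊢
    rwa [cubeTrunc_of_mem hc] at hb
  | insert k X hk ih =>
    rw [Finset.disjoint_insert_right] at hX
    have hkS : k ∉ S ∪ X := by simp [hX.1, hk]
    rw [Finset.union_insert] at hc hd hz ⊢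
    refine cubeCob_insert_of_cubeTrunc hkS (span_image_radical_mono Finset.subset_union_left
      (hz k (Finset.mem_insert_self _ _) hX.1)) hc hd
      (ih ?_ hX.2 (fun l hl => hz l (Finset.mem_insert_of_mem hl)) (cubeTrunc_mem hc) ?_)
    · rwa [cubeTrunc_cubeTrunc Finset.subset_union_left]
    · rw [← cubeTrunc_cubeD (Finset.subset_insert _ _), hd, map_zero]

/-- Truncation to `S` is surjective on cocycles if the other `a k` are in the radical. -/
lemma exists_cocycle_of_subset {S' : Finset (Fin N)} (h : S ⊆ S')
    (hz : ∀ k ∈ S', k ∉ S →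
      a k ∈ (Ideal.span ((fun k => a k * w k) '' (S : Set (Fin N)))).radical)
    {c : Cube a} (hc : c ∈ cubeSupp a ∅ S i) (hd : cubeD a w S c = 0) :
    ∃ c' ∈ cubeSupp a ∅ S' i, cubeD a w S' c' = 0 ∧ cubeTrunc a S c' = c := by
  obtain ⟨X, hX, rfl⟩ : ∃ X, Disjoint S X ∧ S ∪ X = S' :=
    ⟨S' \ S, Finset.disjoint_sdiff, Finset.union_sdiff_of_subset h⟩
  clear h
  induction X using Finset.induction_on with
  | empty =>
    rw [Finset.union_empty]
    exact ⟨c, hc, hd, cubeTrunc_of_mem hc⟩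
  | insert k X hk ih =>
    rw [Finset.disjoint_insert_right] at hX
    have hkS : k ∉ S ∪ X := by simp [hX.1, hk]
    rw [Finset.union_insert] at hz ⊢
    obtain ⟨c₁, hc₁, hd₁, ht₁⟩ := ih hX.2 (fun l hl => hz l (Finset.mem_insert_of_mem hl))
    obtain ⟨c₂, hc₂, hd₂, ht₂⟩ := exists_cocycle_insert hkS
      (span_image_radical_mono Finset.subset_union_left
      (hz k (Finset.mem_insert_self _ _) hX.1)) hc₁ hd₁
    exact ⟨c₂, hc₂, hd₂, by rw [← cubeTrunc_cubeTrunc Finset.subset_union_left, ht₂, ht₁]⟩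

end CubeDifferential

/-! ### Relative Frobenius on cubes and its nilpotence invariants. -/

section CubeFrobenius

variable (p : ℕ) [Fact p.Prime] {A : Type*} [CommRing A] [Algebra (ZMod p) A] {N : ℕ}
  {a : Fin N → A}

variable (a) in
/-- The `m`-th iterate of the Frobenius endomorphism of a cube. -/
def cubeFrob (m : ℕ) : Cube a →+ Cube a where
  toFun c := fun T => c T ^ p ^ m
  map_zero' := funext fun _ => zero_pow (pow_ne_zero _ (Fact.out : p.Prime).ne_zero)
  map_add' c c' := funext fun T => add_pow_frob p m (c T) (c' T)

lemma cubeFrob_apply (m : ℕ) (c : Cube a) (T : Finset (Fin N)) :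
    cubeFrob p a m c T = c T ^ p ^ m := rfl

lemma cubeFrob_cubeFrob (m n : ℕ) (c : Cube a) :
    cubeFrob p a n (cubeFrob p a m c) = cubeFrob p a (m + n) c := by
  ext T
  rw [cubeFrob_apply, cubeFrob_apply, cubeFrob_apply, pow_add, pow_mul]

lemma cubeFrob_smul (m : ℕ) (r : A) (c : Cube a) :
    cubeFrob p a m (r • c) = r ^ p ^ m • cubeFrob p a m c := by
  ext T
  rw [cubeFrob_apply, Pi.smul_apply, Pi.smul_apply, smul_pow, cubeFrob_apply]

lemma cubeSign_pow (m : ℕ) (k : Fin N) (T : Finset (Fin N)) :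
    cubeSign A k T ^ p ^ m = cubeSign A k T := by
  have h : (-1 : A) ^ p ^ m = -1 := by
    rw [← frob_iterate p A m, iterate_map_neg, iterate_map_one]
  rw [cubeSign, ← pow_mul, mul_comm, pow_mul, h]

lemma cubeFrob_wedge (m : ℕ) (k : Fin N) (c : Cube a) :
    cubeFrob p a m (wedge a k c) = wedge a k (cubeFrob p a m c) := by
  ext T
  rw [cubeFrob_apply]
  by_cases h : k ∈ T
  · rw [wedge_apply_of_mem h, wedge_apply_of_mem h, smul_pow, cubeSign_pow, cubeFrob_apply,
      map_pow]
  · rw [wedge_apply_of_notMem h, wedge_apply_of_notMem h,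
      zero_pow (pow_ne_zero _ (Fact.out : p.Prime).ne_zero)]

lemma cubeFrob_cubeD (m : ℕ) (w : Fin N → A) (S : Finset (Fin N)) (c : Cube a) :
    cubeFrob p a m (cubeD a w S c) = cubeD a (w ^ p ^ m) S (cubeFrob p a m c) := by
  rw [cubeD_apply, cubeD_apply, map_sum]
  refine Finset.sum_congr rfl fun k _ => ?_
  rw [cubeFrob_smul, cubeFrob_wedge, Pi.pow_apply]

variable {S₀ S S' : Finset (Fin N)} {i : ℤ} {w : Fin N → A} {k : Fin N}

lemma cubeFrob_mem {c : Cube a} (m : ℕ) (hc : c ∈ cubeSupp a S₀ S i) :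
    cubeFrob p a m c ∈ cubeSupp a S₀ S i := by
  intro T hT
  refine hc T (fun h => hT ?_)
  rw [cubeFrob_apply, h, zero_pow (pow_ne_zero _ (Fact.out : p.Prime).ne_zero)]

lemma cubeTrunc_cubeFrob (m : ℕ) (c : Cube a) :
    cubeTrunc a S (cubeFrob p a m c) = cubeFrob p a m (cubeTrunc a S c) := by
  ext T
  rw [cubeFrob_apply]
  by_cases h : T ⊆ S
  · rw [cubeTrunc_apply_of_subset h, cubeTrunc_apply_of_subset h, cubeFrob_apply]
  · rw [cubeTrunc_apply_of_not_subset h, cubeTrunc_apply_of_not_subset h,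
      zero_pow (pow_ne_zero _ (Fact.out : p.Prime).ne_zero)]

lemma cubeFrob_mem_cubeCob {c : Cube a} (m : ℕ) (hc : c ∈ cubeCob a w S₀ S i) :
    cubeFrob p a m c ∈ cubeCob a (w ^ p ^ m) S₀ S i := by
  obtain ⟨b, hb, rfl⟩ := hc
  exact ⟨cubeFrob p a m b, cubeFrob_mem p m hb, (cubeFrob_cubeD p m w S b).symm⟩

omit [Fact p.Prime] [Algebra (ZMod p) A] in
lemma pow_level (w : Fin N → A) (e m : ℕ) : (w ^ p ^ e) ^ p ^ m = w ^ p ^ (e + m) := by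
  rw [← pow_mul, pow_add]

/-- Every cocycle of the cube on `[∅, S]` is killed by an iterate of the relative Frobenius. -/
def CubeNil (a w : Fin N → A) (S : Finset (Fin N)) (i : ℤ) : Prop :=
  ∀ (e : ℕ), ∀ c ∈ cubeSupp a ∅ S i, cubeD a (w ^ p ^ e) S c = 0 →
    ∃ m, cubeFrob p a m c ∈ cubeCob a (w ^ p ^ (e + m)) ∅ S i

/-- The `h`-th iterate of the relative Frobenius kills the nilpotent cocycles of the cube on
`[∅, S]`. -/
def CubeBd (a w : Fin N → A) (S : Finset (Fin N)) (i : ℤ) (h : ℕ) : Prop :=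
  ∀ (e : ℕ), ∀ c ∈ cubeSupp a ∅ S i, cubeD a (w ^ p ^ e) S c = 0 →
    (∃ m, cubeFrob p a m c ∈ cubeCob a (w ^ p ^ (e + m)) ∅ S i) →
    cubeFrob p a h c ∈ cubeCob a (w ^ p ^ (e + h)) ∅ S i

lemma cubeSupp_eq_bot_of_neg (hi : i < 0) : cubeSupp a S₀ S i = ⊥ := by
  refine (Submodule.eq_bot_iff _).2 fun c hc => ?_
  ext T
  by_contra h
  have := (hc T h).2.2
  omega

lemma cubeNil_of_neg (hi : i < 0) : CubeNil p a w S i := by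
  intro e c hc _
  rw [cubeSupp_eq_bot_of_neg hi, Submodule.mem_bot] at hc
  exact ⟨0, by rw [hc, map_zero]; exact Submodule.zero_mem _⟩

lemma cubeBd_of_neg (hi : i < 0) (h : ℕ) : CubeBd p a w S i h := by
  intro e c hc _ _
  rw [cubeSupp_eq_bot_of_neg hi, Submodule.mem_bot] at hc
  rw [hc, map_zero]; exact Submodule.zero_mem _

/-- The identity (a w)^q = a^{q-1} (a w^q) carries the radical condition to every Frobenius level.
-/
lemma radical_pow_level {z : A} {q : ℕ} (hq : q ≠ 0)
    (hz : z ∈ (Ideal.span ((fun k => a k * w k) '' (S : Set (Fin N)))).radical) :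
    z ∈ (Ideal.span ((fun k => a k * (w ^ q) k) '' (S : Set (Fin N)))).radical := by
  suffices h : (Ideal.span ((fun k => a k * w k) '' (S : Set (Fin N)))).radical ≤
      (Ideal.span ((fun k => a k * (w ^ q) k) '' (S : Set (Fin N)))).radical from h hz
  rw [Ideal.radical_le_radical_iff, Ideal.span_le]
  rintro _ ⟨k, hk, rfl⟩
  refine ⟨q, ?_⟩
  obtain ⟨n, rfl⟩ := Nat.exists_eq_succ_of_ne_zero hq
  have : (a k * w k) ^ n.succ = a k ^ n * (a k * (w ^ n.succ) k) := by
    simp only [Pi.pow_apply, Nat.succ_eq_add_one]; ring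
  simp only [this]
  exact Ideal.mul_mem_left _ _ (Ideal.subset_span ⟨k, hk, rfl⟩)

/-! ### Invariance under adding directions that lie in the radical. -/

section Transfer

variable (h : S ⊆ S') (hz : ∀ k ∈ S', k ∉ S →
  a k ∈ (Ideal.span ((fun k => a k * w k) '' (S : Set (Fin N)))).radical)
include h hz

omit hz in
lemma cubeTrunc_mem_cubeCob {v : Fin N → A} {c : Cube a} (hc : c ∈ cubeCob a v ∅ S' i) :
    cubeTrunc a S c ∈ cubeCob a v ∅ S i := by
  obtain ⟨b, hb, rfl⟩ := hc
  exact ⟨cubeTrunc a S b, cubeTrunc_mem hb, (cubeTrunc_cubeD h b).symm⟩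

lemma cubeFrob_mem_cubeCob_iff_cubeTrunc {e m : ℕ} {c : Cube a} (hc : c ∈ cubeSupp a ∅ S' i)
    (hd : cubeD a (w ^ p ^ e) S' c = 0) :
    cubeFrob p a m c ∈ cubeCob a (w ^ p ^ (e + m)) ∅ S' i ↔
      cubeFrob p a m (cubeTrunc a S c) ∈ cubeCob a (w ^ p ^ (e + m)) ∅ S i := by
  rw [← cubeTrunc_cubeFrob]
  refine ⟨cubeTrunc_mem_cubeCob h, cubeCob_of_cubeTrunc h ?_ (cubeFrob_mem p m hc) ?_⟩
  · exact fun k hk hkS => radical_pow_level (pow_ne_zero _ (Fact.out : p.Prime).ne_zero)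
      (hz k hk hkS)
  · rw [← pow_level, ← cubeFrob_cubeD, hd, map_zero]

omit [Algebra (ZMod p) A] in
lemma exists_cocycle_level (e : ℕ) {c : Cube a} (hc : c ∈ cubeSupp a ∅ S i)
    (hd : cubeD a (w ^ p ^ e) S c = 0) :
    ∃ c' ∈ cubeSupp a ∅ S' i, cubeD a (w ^ p ^ e) S' c' = 0 ∧ cubeTrunc a S c' = c :=
  exists_cocycle_of_subset h (fun k hk hkS =>
    radical_pow_level (pow_ne_zero _ (Fact.out : p.Prime).ne_zero) (hz k hk hkS)) hc hd

omit [Fact p.Prime] [Algebra (ZMod p) A] hz in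
lemma cubeTrunc_cocycle {e : ℕ} {c : Cube a} (hd : cubeD a (w ^ p ^ e) S' c = 0) :
    cubeD a (w ^ p ^ e) S (cubeTrunc a S c) = 0 := by
  rw [← cubeTrunc_cubeD h, hd, map_zero]

lemma cubeNil_iff_of_subset : CubeNil p a w S i ↔ CubeNil p a w S' i := by
  constructor
  · intro H e c hc hd
    obtain ⟨m, hm⟩ := H e _ (cubeTrunc_mem hc) (cubeTrunc_cocycle p h hd)
    exact ⟨m, (cubeFrob_mem_cubeCob_iff_cubeTrunc p h hz hc hd).2 hm⟩
  · intro H e c hc hd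
    obtain ⟨c', hc', hd', rfl⟩ := exists_cocycle_level p h hz e hc hd
    obtain ⟨m, hm⟩ := H e c' hc' hd'
    exact ⟨m, (cubeFrob_mem_cubeCob_iff_cubeTrunc p h hz hc' hd').1 hm⟩

/-- Truncation is bijective on cohomology at every level and commutes with Frobenius, so it
preserves the exponent exactly. -/
lemma cubeBd_iff_of_subset (n : ℕ) : CubeBd p a w S i n ↔ CubeBd p a w S' i n := by
  constructor
  · rintro H e c hc hd ⟨m, hm⟩
    exact (cubeFrob_mem_cubeCob_iff_cubeTrunc p h hz hc hd).2
      (H e _ (cubeTrunc_mem hc) (cubeTrunc_cocycle p h hd)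
        ⟨m, (cubeFrob_mem_cubeCob_iff_cubeTrunc p h hz hc hd).1 hm⟩)
  · rintro H e c hc hd ⟨m, hm⟩
    obtain ⟨c', hc', hd', rfl⟩ := exists_cocycle_level p h hz e hc hd
    exact (cubeFrob_mem_cubeCob_iff_cubeTrunc p h hz hc' hd').1 
      (H e c' hc' hd' ⟨m, (cubeFrob_mem_cubeCob_iff_cubeTrunc p h hz hc' hd').2 hm⟩)

end Transfer

/-! ### Adding a Koszul direction. -/

section Koszul

variable (hk : k ∉ S) (ha : a k = 1)
include hk ha

/-- Exactness of the cone sequence at its middle term. Once Frobenius makes the truncation of c a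
coboundary, c becomes cohomologous to the k-direction of a cochain g on S. Because a k = 1 this
direction is injective on cochains without k, which forces g to be a cocycle, of degree i - 1 and
level e + n. -/
lemma exists_koszul_cocycle {e n : ℕ} {c : Cube a} (hc : c ∈ cubeSupp a ∅ (insert k S) i)
    (hd : cubeD a (w ^ p ^ e) (insert k S) c = 0)
    (hn : cubeFrob p a n (cubeTrunc a S c) ∈ cubeCob a (w ^ p ^ (e + n)) ∅ S i) :
    ∃ g ∈ cubeSupp a ∅ S (i - 1), cubeD a (w ^ p ^ (e + n)) S g = 0 ∧
      ∀ m, cubeFrob p a m g ∈ cubeCob a (w ^ p ^ (e + n + m)) ∅ S (i - 1) →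
        cubeFrob p a (n + m) c ∈ cubeCob a (w ^ p ^ (e + (n + m))) ∅ (insert k S) i := by
  obtain ⟨b, hb, hbc⟩ := hn
  have hb' := cubeSupp_mono (le_refl ∅) (Finset.subset_insert k S) hb
  set v := w ^ p ^ (e + n)
  let c' := cubeFrob p a n c - cubeD a v (insert k S) b
  have hc' : c' ∈ cubeSupp a (insert k ∅) (insert k S) i := by
    have h1 : c' ∈ cubeSupp a ∅ (insert k S) i :=
      Submodule.sub_mem _ (cubeFrob_mem p n hc) (cubeCob_le ⟨b, hb', rfl⟩)
    have h2 := sub_cubeTrunc_mem h1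
    rwa [map_sub, cubeTrunc_cubeD (Finset.subset_insert k S), cubeTrunc_of_mem hb, hbc,
      cubeTrunc_cubeFrob, sub_self, sub_zero] at h2
  have hd' : cubeD a v (insert k S) c' = 0 := by
    simp only [c', v]
    rw [map_sub, cubeD_cubeD, ← pow_level, ← cubeFrob_cubeD, hd, map_zero, sub_zero]
  obtain ⟨_, g, hg, hgc⟩ := exists_wedge_eq_pow_smul (Finset.notMem_empty k) hc'
  rw [ha, one_pow, one_smul] at hgc
  have hdg : cubeD a v S g = 0 := by
    rw [cubeD_insert_of_mem_cubeSupp hk hc', ← hgc, ← neg_neg (cubeD a v S _), ← wedge_cubeD,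
      neg_eq_zero] at hd'
    have hs := cubeD_mem_cubeSupp (w := v) hg
    obtain ⟨_, h⟩ := exists_pow_smul_eq_zero_of_wedge hk hs hd'
    rwa [ha, one_pow, one_smul] at h
  refine ⟨g, hg, hdg, ?_⟩
  rintro m ⟨g', hg', hgg⟩
  rw [← cubeFrob_cubeFrob, ← add_assoc]
  have : cubeFrob p a n c = c' + cubeD a v (insert k S) b := by simp [c']
  rw [this, map_add]
  refine Submodule.add_mem _ ?_ ?_
  · rw [← hgc, cubeFrob_wedge, ← hgg]
    have hw := wedge_mem_cubeSupp (k := k) hg'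
    rw [sub_add_cancel] at hw
    refine ⟨- wedge a k g', Submodule.neg_mem _ (cubeSupp_mono (Finset.empty_subset _) le_rfl hw),
      ?_⟩
    rw [map_neg, cubeD_insert_of_mem_cubeSupp hk hw, wedge_cubeD]
  · rw [← pow_level]
    exact cubeFrob_mem_cubeCob p m ⟨b, hb', rfl⟩

lemma cubeNil_insert (h : CubeNil p a w S i) (h' : CubeNil p a w S (i - 1)) :
    CubeNil p a w (insert k S) i := by
  intro e c hc hd
  obtain ⟨n, hn⟩ := h e _ (cubeTrunc_mem hc)
    (by rw [← cubeTrunc_cubeD (Finset.subset_insert k S), hd, map_zero])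
  obtain ⟨g, hg, hdg, H⟩ := exists_koszul_cocycle p hk ha hc hd hn
  obtain ⟨m, hm⟩ := h' _ g hg hdg
  exact ⟨n + m, H m hm⟩

/-- The class of degree i - 1 found by `exists_koszul_cocycle` is determined only up to the kernel
of a connecting map, so nilpotence of c says nothing about it. Hence nilpotence of the whole
cohomology in degree i - 1 is required. -/
lemma cubeBd_insert {n n' : ℕ} (h : CubeBd p a w S i n) (h' : CubeNil p a w S (i - 1))
    (h'' : CubeBd p a w S (i - 1) n') : CubeBd p a w (insert k S) i (n + n') := by
  rintro e c hc hd ⟨m, hm⟩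
  have hn := h e _ (cubeTrunc_mem hc)
    (by rw [← cubeTrunc_cubeD (Finset.subset_insert k S), hd, map_zero])
    ⟨m, by
      rw [← cubeTrunc_cubeFrob]
      exact cubeTrunc_mem_cubeCob (Finset.subset_insert k S) hm⟩
  obtain ⟨g, hg, hdg, H⟩ := exists_koszul_cocycle p hk ha hc hd hn
  exact H n' (h'' _ g hg hdg (h' _ g hg hdg))

end Koszul

/-- Pascal's rule, matching the addition of bounds in degrees i and i - 1 when one Koszul direction
is added. -/
lemma sum_choose_succ (n : ℕ) (h : ℤ → ℕ) (i : ℤ) :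
    ∑ l ∈ Finset.range (n + 2), (n + 1).choose l * h (i - l) =
      ∑ l ∈ Finset.range (n + 1), n.choose l * h (i - l) +
      ∑ l ∈ Finset.range (n + 1), n.choose l * h (i - 1 - l) := by
  rw [Finset.sum_range_succ', Finset.sum_range_succ' (fun l => n.choose l * h (i - l)) n]
  have : ∀ l : ℕ, (n + 1).choose (l + 1) * h (i - ((l + 1 : ℕ) : ℤ)) =
      n.choose l * h (i - 1 - l) + n.choose (l + 1) * h (i - ((l + 1 : ℕ) : ℤ)) := by
    intro l
    rw [Nat.choose_succ_succ, add_mul]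
    congr 3
    push_cast; ring
  rw [Finset.sum_congr rfl (fun l _ => this l), Finset.sum_add_distrib,
    Finset.sum_range_succ (fun l => n.choose (l + 1) * h (i - ((l + 1 : ℕ) : ℤ))) n]
  simp
  ring

/-- Adding the Koszul indices `X` to a cube. -/
lemma cubeNil_and_cubeBd_union {X : Finset (Fin N)} (hX : Disjoint S X) (ha : ∀ k ∈ X, a k = 1)
    {d : ℤ} {h : ℤ → ℕ} (hnil : ∀ i < d, CubeNil p a w S i)
    (hbd : ∀ i ≤ d, CubeBd p a w S i (h i)) :
    (∀ i < d, CubeNil p a w (S ∪ X) i) ∧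
    ∀ i ≤ d, CubeBd p a w (S ∪ X) i
      (∑ l ∈ Finset.range (X.card + 1), X.card.choose l * h (i - l)) := by
  induction X using Finset.induction_on with
  | empty =>
    rw [Finset.union_empty]
    refine ⟨hnil, fun i hi => ?_⟩
    have := hbd i hi
    simpa using this
  | insert k X hk ih =>
    rw [Finset.disjoint_insert_right] at hX
    have hkS : k ∉ S ∪ X := by simp [hX.1, hk]
    have hak := ha k (Finset.mem_insert_self _ _)
    obtain ⟨ih1, ih2⟩ := ih hX.2 (fun l hl => ha l (Finset.mem_insert_of_mem hl))
    rw [Finset.union_insert, Finset.card_insert_of_notMem hk]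
    refine ⟨fun i hi => cubeNil_insert p hkS hak (ih1 i hi) (ih1 _ (by omega)), fun i hi => ?_⟩
    rw [sum_choose_succ]
    exact cubeBd_insert p hkS hak (ih2 i hi) (ih1 _ (by omega)) (ih2 _ (by omega))

end CubeFrobenius

/-! ### Čech cohomology as cohomology of cubes -/

section CechElements

variable (p : ℕ) [Fact p.Prime] {A : Type*} [CommRing A] [Algebra (ZMod p) A] {n : ℕ}
  (x : Fin n → A)

/-- The `m`-th iterate of the Frobenius of the Čech complex. -/
def cechPow (j : ℤ) (m : ℕ) : Cech x j →+ Cech x j where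
  toFun c := fun T => c T ^ p ^ m
  map_zero' := funext fun _ => zero_pow (pow_ne_zero _ (Fact.out : p.Prime).ne_zero)
  map_add' c c' := funext fun T => add_pow_frob p m (c T) (c' T)

lemma cechPow_apply (j : ℤ) (m : ℕ) (c : Cech x j) (T) : cechPow p x j m c T = c T ^ p ^ m := rfl

lemma cechPow_cechPow (j : ℤ) (m m' : ℕ) (c : Cech x j) :
    cechPow p x j m' (cechPow p x j m c) = cechPow p x j (m + m') c := by
  ext T
  simp only [cechPow_apply, pow_add, pow_mul]

lemma cechFrob_cechPow (j : ℤ) (m : ℕ) (c : Cech x j) :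
    cechFrob x p j (cechPow p x j m c) = cechPow p x j (m + 1) c := by
  ext T
  change (c T ^ p ^ m) ^ p = c T ^ p ^ (m + 1)
  rw [pow_succ, pow_mul]

lemma cechD_cechPow (i j : ℤ) (m : ℕ) (c : Cech x i) :
    cechD x i j (cechPow p x i m c) = cechPow p x j m (cechD x i j c) := by
  induction m with
  | zero =>
    have h : ∀ (j : ℤ) (c : Cech x j), cechPow p x j 0 c = c := fun j c => by
      ext T; simp [cechPow_apply]
    rw [h, h]
  | succ m ih => rw [← cechFrob_cechPow, cechD_cechFrob, ih, cechFrob_cechPow]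

/-- Every Čech cocycle is killed by an iterate of the Frobenius. -/
def CechNil (j : ℤ) : Prop :=
  ∀ c : Cech x j, cechD x j (j + 1) c = 0 → ∃ m, ∃ b, cechD x (j - 1) j b = cechPow p x j m c

/-- The `h`-th iterate of the Frobenius kills all nilpotent Čech cocycles. -/
def CechBd (j : ℤ) (h : ℕ) : Prop :=
  ∀ c : Cech x j, cechD x j (j + 1) c = 0 → (∃ m, ∃ b, cechD x (j - 1) j b = cechPow p x j m c) →
    ∃ b, cechD x (j - 1) j b = cechPow p x j h c

lemma cocycleFrob_iterate (j : ℤ) (m : ℕ) (c : LinearMap.ker (cechD x j (j + 1))) :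
    (((cocycleFrob x p j)^[m] c : LinearMap.ker (cechD x j (j + 1))) : Cech x j) =
      cechPow p x j m c := by
  induction m with
  | zero => ext T; simp [cechPow_apply]
  | succ m ih =>
    rw [Function.iterate_succ_apply', ← cechFrob_cechPow, ← ih]; rfl

lemma cohFrob_iterate_mk (j : ℤ) (m : ℕ) (c : LinearMap.ker (cechD x j (j + 1))) :
    (cohFrob x p j)^[m] (Submodule.Quotient.mk c) =
      Submodule.Quotient.mk ((cocycleFrob x p j)^[m] c) := by
  induction m with
  | zero => rfl
  | succ m ih =>
    rw [Function.iterate_succ_apply', Function.iterate_succ_apply', ih]; rfl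

lemma cohFrob_iterate_mk_eq_zero (j : ℤ) (m : ℕ) (c : LinearMap.ker (cechD x j (j + 1))) :
    (cohFrob x p j)^[m] (Submodule.Quotient.mk c) = 0 ↔
      ∃ b, cechD x (j - 1) j b = cechPow p x j m c := by
  rw [cohFrob_iterate_mk, Submodule.Quotient.mk_eq_zero, ← cocycleFrob_iterate]
  rfl

lemma isNilpotentAction_cohFrob (j : ℤ) :
    IsNilpotentAction (cohFrob x p j) ↔ CechNil p x j := by
  constructor
  · intro h c hc
    obtain ⟨m, hm⟩ := h (Submodule.Quotient.mk ⟨c, hc⟩)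
    exact ⟨m, (cohFrob_iterate_mk_eq_zero p x j m _).1 hm⟩
  · intro h c
    obtain ⟨⟨c, hc⟩, rfl⟩ := Submodule.Quotient.mk_surjective _ c
    obtain ⟨m, hm⟩ := h c hc
    exact ⟨m, (cohFrob_iterate_mk_eq_zero p x j m _).2 hm⟩

lemma CechBd.mono {j : ℤ} {h h' : ℕ} (hh : h ≤ h') (H : CechBd p x j h) : CechBd p x j h' := by
  intro c hc hm
  obtain ⟨b, hb⟩ := H c hc hm
  refine ⟨cechPow p x (j - 1) (h' - h) b, ?_⟩
  rw [cechD_cechPow, hb, cechPow_cechPow, Nat.add_sub_cancel' hh]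

/-- The admissible exponents are upward closed by `CechBd.mono`, so a finite bound on the infimum is
itself admissible. -/
lemma hsl_cohFrob_le (j : ℤ) (h : ℕ) : HSL (cohFrob x p j) ≤ h ↔ CechBd p x j h := by
  have key : ∀ e : ℕ, (∀ m, (∃ k : ℕ, (cohFrob x p j)^[k] m = 0) → (cohFrob x p j)^[e] m = 0) ↔
      CechBd p x j e := by
    intro e
    constructor
    · rintro H c hc ⟨k, hk⟩
      exact (cohFrob_iterate_mk_eq_zero p x j e ⟨c, hc⟩).1
        (H _ ⟨k, (cohFrob_iterate_mk_eq_zero p x j k ⟨c, hc⟩).2 hk⟩)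
    · rintro H c ⟨k, hk⟩
      obtain ⟨⟨c, hc⟩, rfl⟩ := Submodule.Quotient.mk_surjective _ c
      exact (cohFrob_iterate_mk_eq_zero p x j e ⟨c, hc⟩).2
        (H c hc ⟨k, (cohFrob_iterate_mk_eq_zero p x j k ⟨c, hc⟩).1 hk⟩)
  constructor
  · intro hle
    have hlt : HSL (cohFrob x p j) < ((h + 1 : ℕ) : ℕ∞) :=
      lt_of_le_of_lt hle (by exact_mod_cast Nat.lt_succ_self h)
    simp only [HSL, iInf_lt_iff] at hlt
    obtain ⟨e, he, hlt⟩ := hlt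
    exact ((key e).1 he).mono p x (Nat.lt_succ_iff.1 (by exact_mod_cast hlt))
  · intro H
    exact iInf₂_le h ((key h).2 H)

lemma cechBd_of_lt {j : ℤ} (hj : (n : ℤ) < j) (h : ℕ) : CechBd p x j h := by
  intro c _ _
  refine ⟨0, funext fun T => absurd T.2 ?_⟩
  have := Finset.card_le_univ T.1
  rw [Fintype.card_fin] at this
  omega

lemma cechNil_of_neg {j : ℤ} (hj : j < 0) : CechNil p x j := by
  intro c _
  refine ⟨0, 0, funext fun T => absurd T.2 ?_⟩
  omega

lemma cechBd_of_neg {j : ℤ} (hj : j < 0) (h : ℕ) : CechBd p x j h := by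
  intro c _ _
  refine ⟨0, funext fun T => absurd T.2 ?_⟩
  omega

end CechElements

/-! ### Sub-Čech complexes as faces of a cube with weights 1. -/

section Link

variable {A : Type*} [CommRing A] {n N : ℕ} (a : Fin N → A) (φ : Fin n ↪o Fin N)

/-- Restriction of a cochain of a cube to the sub-Čech complex on the indices `φ`. -/
def cubeToCech (i : ℤ) : Cube a →ₗ[A] Cech (fun k => a (φ k)) i :=
  LinearMap.pi fun T => (awayRes (Finset.prod_map T.1 φ.toEmbedding a).dvd).toLinearMap ∘ₗ
    LinearMap.proj (T.1.map φ.toEmbedding)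

lemma cubeToCech_apply (i : ℤ) (c : Cube a) (T : {T : Finset (Fin n) // (T.card : ℤ) = i}) :
    cubeToCech a φ i c T =
      awayRes (Finset.prod_map T.1 φ.toEmbedding a).dvd (c (T.1.map φ.toEmbedding)) := rfl

lemma awayRes_bijective {f g : A} (h : f ∣ g) (h' : g ∣ f) : Function.Bijective (awayRes h) := by
  refine Function.bijective_iff_has_inverse.2 ⟨awayRes h', fun z => ?_, fun z => ?_⟩ <;>
  rw [awayRes_awayRes, awayRes_self]

lemma cubeSign_map (k : Fin n) (T : Finset (Fin n)) :
    cubeSign A (φ k) (T.map φ.toEmbedding) = cubeSign A k T := by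
  unfold cubeSign
  rw [Finset.filter_map, Finset.card_map]
  congr 3
  ext l
  simp

lemma awayRes_congr {i : ℤ} {x : Fin n → A} (c : Cech x i)
    {T T' : {T : Finset (Fin n) // (T.card : ℤ) = i}} (e : T = T') {g : A}
    (h : ∏ k ∈ T.1, x k ∣ g) (h' : ∏ k ∈ T'.1, x k ∣ g) :
    awayRes h (c T) = awayRes h' (c T') := by
  subst e; rfl

lemma cube_awayRes_congr (c : Cube a) {T T' : Finset (Fin N)} (e : T = T') {g : A}
    (h : ∏ k ∈ T, a k ∣ g) (h' : ∏ k ∈ T', a k ∣ g) :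
    awayRes h (c T) = awayRes h' (c T') := by
  subst e; rfl

lemma cubeToCech_cubeD {i j : ℤ} (hij : j = i + 1) {w : Fin N → A} (hw : ∀ k, w (φ k) = 1)
    (c : Cube a) :
    cubeToCech a φ j (cubeD a w (Finset.univ.map φ.toEmbedding) c) =
      cechD (fun k => a (φ k)) i j (cubeToCech a φ i c) := by
  ext T
  rw [cubeToCech_apply, cubeD_apply, Finset.sum_apply, Finset.sum_map, map_sum]
  simp only [cechD, LinearMap.pi_apply, LinearMap.sum_apply, LinearMap.smul_apply]
  rw [← Finset.sum_subset (Finset.subset_univ T.1), ← Finset.sum_coe_sort]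
  · refine Finset.sum_congr rfl fun k _ => ?_
    have hcard : ((T.1.erase k.1).card : ℤ) = i := by
      have := T.2
      have h2 := Finset.card_erase_add_one k.2
      omega
    rw [dif_pos hcard]
    have hkm : φ k.1 ∈ T.1.map φ.toEmbedding := Finset.mem_map_of_mem φ.toEmbedding k.2
    simp only [RelEmbedding.coe_toEmbedding, Pi.smul_apply]
    rw [hw, one_smul, wedge_apply_of_mem hkm, cubeSign_map, map_smul, LinearMap.comp_apply,
      LinearMap.proj_apply, AlgHom.toLinearMap_apply, cubeToCech_apply, awayRes_awayRes,
      cubeRes, awayRes_awayRes, cubeSign,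
      cube_awayRes_congr a c (show (T.1.map φ.toEmbedding).erase (φ k.1) =
          (T.1.erase k.1).map φ.toEmbedding from (Finset.map_erase φ.toEmbedding T.1 k.1).symm) _
        (((Finset.map_erase φ.toEmbedding T.1 k.1) ▸
          Finset.prod_dvd_prod_of_subset _ _ a (Finset.erase_subset _ _)).trans
          (Finset.prod_map T.1 φ.toEmbedding a).dvd)]
    rcases neg_one_pow_eq_or ℤ (T.1.filter (fun l => l < k.1)).card with h | h
    · rw [h, one_zsmul]
      have : (-1 : A) ^ (T.1.filter (fun l => l < k.1)).card = 1 := by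
        have := congr_arg (Int.cast : ℤ → A) h
        simpa using this
      rw [this, one_smul]
    · rw [h, neg_smul, one_zsmul]
      have : (-1 : A) ^ (T.1.filter (fun l => l < k.1)).card = -1 := by
        have := congr_arg (Int.cast : ℤ → A) h
        simpa using this
      rw [this, neg_smul, one_smul]
  · intro k _ hk
    rw [Pi.smul_apply, wedge_apply_of_notMem, smul_zero, map_zero]
    simpa using hk

lemma eq_zero_of_cubeToCech_eq_zero {i : ℤ} {c : Cube a}
    (hc : c ∈ cubeSupp a ∅ (Finset.univ.map φ.toEmbedding) i)
    (h : cubeToCech a φ i c = 0) : c = 0 := by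
  ext U
  by_contra h0
  obtain ⟨-, h2, h3⟩ := hc U h0
  obtain ⟨T, -, rfl⟩ := Finset.subset_map_iff.1 h2
  rw [Finset.card_map] at h3
  have := congr_fun h ⟨T, h3⟩
  rw [cubeToCech_apply] at this
  refine h0 ((awayRes_bijective (Finset.prod_map T φ.toEmbedding a).dvd
    (Finset.prod_map T φ.toEmbedding a).symm.dvd).1 ?_)
  rw [Pi.zero_apply, map_zero]
  exact this

lemma exists_cubeToCech_eq {i : ℤ} (c : Cech (fun k => a (φ k)) i) :
    ∃ c' ∈ cubeSupp a ∅ (Finset.univ.map φ.toEmbedding) i, cubeToCech a φ i c' = c := by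
  classical
  have hmap : ∀ U : Finset (Fin N), U ⊆ Finset.univ.map φ.toEmbedding →
      (U.preimage φ φ.injective.injOn).map φ.toEmbedding = U := by
    intro U hU
    obtain ⟨T, -, rfl⟩ := Finset.subset_map_iff.1 hU
    congr 1
    ext k
    simp
  refine ⟨fun U => if h : U ⊆ Finset.univ.map φ.toEmbedding ∧ (U.card : ℤ) = i then
    awayRes (((Finset.prod_map _ φ.toEmbedding a).symm.trans (by rw [hmap U h.1])).dvd)
      (c ⟨U.preimage φ φ.injective.injOn, by
        rw [← Finset.card_map φ.toEmbedding, hmap U h.1]; exact h.2⟩) else 0, ?_, ?_⟩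
  · intro U hU
    by_cases h : U ⊆ Finset.univ.map φ.toEmbedding ∧ (U.card : ℤ) = i
    · exact ⟨Finset.empty_subset _, h⟩
    · exact absurd (dif_neg h) hU
  · ext T
    rw [cubeToCech_apply, dif_pos ⟨Finset.map_subset_map.2 (Finset.subset_univ _), by
      rw [Finset.card_map]; exact T.2⟩, awayRes_awayRes]
    rw [awayRes_congr c (T' := T) (Subtype.ext (by ext k; simp)) _ (dvd_refl _), awayRes_self]

variable (p : ℕ) [Fact p.Prime] [Algebra (ZMod p) A]

lemma cubeToCech_cubeFrob (i : ℤ) (m : ℕ) (c : Cube a) :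
    cubeToCech a φ i (cubeFrob p a m c) = cechPow p _ i m (cubeToCech a φ i c) := by
  ext T
  rw [cubeToCech_apply, cechPow_apply, cubeToCech_apply, cubeFrob_apply, map_pow]

variable {w : Fin N → A} (hw : ∀ k, w (φ k) = 1)
include hw

omit [Fact p.Prime] [Algebra (ZMod p) A] in
lemma cubeToCech_cocycle_iff (e : ℕ) {i : ℤ} {c : Cube a}
    (hc : c ∈ cubeSupp a ∅ (Finset.univ.map φ.toEmbedding) i) :
    cubeD a (w ^ p ^ e) (Finset.univ.map φ.toEmbedding) c = 0 ↔
      cechD (fun k => a (φ k)) i (i + 1) (cubeToCech a φ i c) = 0 := by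
  have hw' : ∀ k, (w ^ p ^ e) (φ k) = 1 := fun k => by rw [Pi.pow_apply, hw, one_pow]
  rw [← cubeToCech_cubeD a φ rfl hw']
  exact ⟨fun h => by rw [h, map_zero], eq_zero_of_cubeToCech_eq_zero a φ (cubeD_mem_cubeSupp hc)⟩

lemma cubeFrob_mem_cubeCob_iff_cech (e m : ℕ) {i : ℤ} {c : Cube a}
    (hc : c ∈ cubeSupp a ∅ (Finset.univ.map φ.toEmbedding) i) :
    cubeFrob p a m c ∈ cubeCob a (w ^ p ^ e) ∅ (Finset.univ.map φ.toEmbedding) i ↔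
      ∃ b, cechD (fun k => a (φ k)) (i - 1) i b =
        cechPow p (fun k => a (φ k)) i m (cubeToCech a φ i c) := by
  have hw' : ∀ k, (w ^ p ^ e) (φ k) = 1 := fun k => by rw [Pi.pow_apply, hw, one_pow]
  rw [← cubeToCech_cubeFrob]
  constructor
  · rintro ⟨b, -, hb⟩
    exact ⟨cubeToCech a φ (i - 1) b, by
      rw [← hb, cubeToCech_cubeD a φ (sub_add_cancel i 1).symm hw']⟩
  · rintro ⟨b, hb⟩
    obtain ⟨b, hbS, rfl⟩ := exists_cubeToCech_eq a φ b
    rw [← cubeToCech_cubeD a φ (sub_add_cancel i 1).symm hw'] at hb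
    refine ⟨b, hbS, sub_eq_zero.1 (eq_zero_of_cubeToCech_eq_zero a φ
      (Submodule.sub_mem _ ?_ (cubeFrob_mem p m hc)) ?_)⟩
    · have := cubeD_mem_cubeSupp (w := w ^ p ^ e) hbS
      rwa [sub_add_cancel] at this
    · rw [map_sub, hb, sub_self]

/-- Weights equal to 1 are fixed by Frobenius, so all levels e coincide and the relative Frobenius
is the ordinary one. -/
lemma cubeNil_iff_cechNil (i : ℤ) :
    CubeNil p a w (Finset.univ.map φ.toEmbedding) i ↔ CechNil p (fun k => a (φ k)) i := by
  constructor
  · intro H c hd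
    obtain ⟨c, hc, rfl⟩ := exists_cubeToCech_eq a φ c
    obtain ⟨m, hm⟩ := H 0 c hc ((cubeToCech_cocycle_iff a φ p hw 0 hc).2 hd)
    exact ⟨m, (cubeFrob_mem_cubeCob_iff_cech a φ p hw _ m hc).1 hm⟩
  · intro H e c hc hd
    obtain ⟨m, hm⟩ := H _ ((cubeToCech_cocycle_iff a φ p hw e hc).1 hd)
    exact ⟨m, (cubeFrob_mem_cubeCob_iff_cech a φ p hw _ m hc).2 hm⟩

lemma cubeBd_iff_cechBd (i : ℤ) (h : ℕ) :
    CubeBd p a w (Finset.univ.map φ.toEmbedding) i h ↔ CechBd p (fun k => a (φ k)) i h := by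
  constructor
  · rintro H c hd ⟨m, hm⟩
    obtain ⟨c, hc, rfl⟩ := exists_cubeToCech_eq a φ c
    exact (cubeFrob_mem_cubeCob_iff_cech a φ p hw _ h hc).1
      (H 0 c hc ((cubeToCech_cocycle_iff a φ p hw 0 hc).2 hd)
        ⟨m, (cubeFrob_mem_cubeCob_iff_cech a φ p hw _ m hc).2 hm⟩)
  · rintro H e c hc hd ⟨m, hm⟩
    exact (cubeFrob_mem_cubeCob_iff_cech a φ p hw _ h hc).2
      (H _ ((cubeToCech_cocycle_iff a φ p hw e hc).1 hd)
        ⟨m, (cubeFrob_mem_cubeCob_iff_cech a φ p hw _ m hc).1 hm⟩)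

end Link

/-! ### Independence of the generators. -/

section Independence

variable (p : ℕ) [Fact p.Prime] {A : Type*} [CommRing A] [Algebra (ZMod p) A] {m n : ℕ}
  {x : Fin m → A} {y : Fin n → A}

omit [CommRing A] in
lemma image_castAdd (f : Fin (m + n) → A) :
    f '' ((Finset.univ.map (Fin.castAddOrderEmb n : Fin m ↪o Fin (m + n)).toEmbedding :
      Finset (Fin (m + n))) : Set (Fin (m + n))) = Set.range fun k => f (Fin.castAdd n k) := by
  ext r; simp; rfl

omit [CommRing A] in
lemma image_natAdd (f : Fin (m + n) → A) :
    f '' ((Finset.univ.map (Fin.natAddOrderEmb m : Fin n ↪o Fin (m + n)).toEmbedding :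
      Finset (Fin (m + n))) : Set (Fin (m + n))) = Set.range fun k => f (Fin.natAdd m k) := by
  ext r; simp; rfl

/-- The Frobenius invariants of Čech cohomology only depend on the radical of the ideal. -/
lemma cechNil_and_cechBd_of_radical_eq
    (h : (Ideal.span (Set.range x)).radical = (Ideal.span (Set.range y)).radical) (j : ℤ) :
    (CechNil p x j ↔ CechNil p y j) ∧ ∀ e, CechBd p x j e ↔ CechBd p y j e := by
  -- The cube on both sequences truncates to the Čech complex of x and to that of y; equality of
  -- radicals makes both truncations isomorphisms on cohomology.
  let a : Fin (m + n) → A := Fin.append x y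
  let φ : Fin m ↪o Fin (m + n) := Fin.castAddOrderEmb n
  let ψ : Fin n ↪o Fin (m + n) := Fin.natAddOrderEmb m
  have hx : x = fun k => a (φ k) := funext fun k => (Fin.append_left x y k).symm
  have hy : y = fun k => a (ψ k) := funext fun k => (Fin.append_right x y k).symm
  have hrad : ∀ k, a k ∈ (Ideal.span (Set.range x)).radical := by
    intro k
    refine Fin.addCases (fun k => ?_) (fun k => ?_) k
    · simp only [a, Fin.append_left]
      exact Ideal.le_radical (Ideal.subset_span ⟨k, rfl⟩)
    · simp only [a, Fin.append_right]
      rw [h]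
      exact Ideal.le_radical (Ideal.subset_span ⟨k, rfl⟩)
  have h1 : ∀ k ∈ Finset.univ, k ∉ Finset.univ.map φ.toEmbedding →
      a k ∈ (Ideal.span ((fun k => a k * (1 : Fin (m + n) → A) k) ''
        ((Finset.univ.map φ.toEmbedding : Finset _) : Set (Fin (m + n))))).radical := by
    intro k _ _
    simp only [φ, image_castAdd, Pi.one_apply, mul_one, a, Fin.append_left]
    exact hrad k
  have h2 : ∀ k ∈ Finset.univ, k ∉ Finset.univ.map ψ.toEmbedding →
      a k ∈ (Ideal.span ((fun k => a k * (1 : Fin (m + n) → A) k) ''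
        ((Finset.univ.map ψ.toEmbedding : Finset _) : Set (Fin (m + n))))).radical := by
    intro k _ _
    simp only [ψ, image_natAdd, Pi.one_apply, mul_one, a, Fin.append_right]
    rw [← h]
    exact hrad k
  have e1 := fun k => (rfl : (1 : Fin (m + n) → A) (φ k) = 1)
  have e2 := fun k => (rfl : (1 : Fin (m + n) → A) (ψ k) = 1)
  rw [hx, hy]
  refine ⟨?_, fun e => ?_⟩
  · rw [← cubeNil_iff_cechNil a φ p e1, ← cubeNil_iff_cechNil a ψ p e2,
      cubeNil_iff_of_subset p (Finset.subset_univ _) h1,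
      cubeNil_iff_of_subset p (Finset.subset_univ _) h2]
  · rw [← cubeBd_iff_cechBd a φ p e1, ← cubeBd_iff_cechBd a ψ p e2,
      cubeBd_iff_of_subset p (Finset.subset_univ _) h1,
      cubeBd_iff_of_subset p (Finset.subset_univ _) h2]

end Independence

/-! ### Frobenius test exponents of ideals generated by sequences -/

section TopKoszul

variable {A : Type*} [CommRing A] {N : ℕ} (a : Fin N → A) (X : Finset (Fin N))

/-- The cochain concentrated on the index set `X`. -/
def topCochain : A →ₗ[A] Cube a :=
  LinearMap.single A (fun T => CechLoc a T) X ∘ₗ Algebra.linearMap A (CechLoc a X)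

lemma topCochain_self (r : A) : topCochain a X r X = algebraMap A (CechLoc a X) r := by
  change Pi.single X (algebraMap A (CechLoc a X) r) X = _
  rw [Pi.single_eq_same]

lemma topCochain_of_ne (r : A) {T : Finset (Fin N)} (h : T ≠ X) : topCochain a X r T = 0 := by
  change Pi.single X (algebraMap A (CechLoc a X) r) T = _
  rw [Pi.single_eq_of_ne h]

lemma topCochain_mem (r : A) : topCochain a X r ∈ cubeSupp a X X X.card := by
  intro T hT
  obtain rfl : T = X := by
    by_contra h
    exact hT (topCochain_of_ne a X r h)
  exact ⟨le_rfl, le_rfl, rfl⟩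

variable {a X}

lemma cubeSupp_eq_bot_of_card_lt {S₀ : Finset (Fin N)} {i : ℤ} (hi : (X.card : ℤ) < i) :
    cubeSupp a S₀ X i = ⊥ := by
  refine (Submodule.eq_bot_iff _).2 fun c hc => ?_
  ext T
  by_contra h
  obtain ⟨-, h2, h3⟩ := hc T h
  have := Finset.card_le_card h2
  omega

variable (ha : ∀ k ∈ X, a k = 1)
include ha

lemma bijective_algebraMap_cechLoc :
    Function.Bijective (algebraMap A (CechLoc a X)) := by
  have h : Submonoid.powers (∏ k ∈ X, a k) ≤ IsUnit.submonoid A := by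
    rw [Finset.prod_eq_one ha, Submonoid.powers_one]
    exact bot_le
  exact (IsLocalization.atUnits A (Submonoid.powers (∏ k ∈ X, a k)) h).bijective

/-- The top Koszul cohomology on the weights v is A/(v). Each generator v k is the differential of a
cochain supported on X.erase k; its other partial differentials vanish for degree reasons. -/
lemma topCochain_mem_cubeCob_iff (v : Fin N → A) (r : A) :
    topCochain a X r ∈ cubeCob a v ∅ X X.card ↔ r ∈ Ideal.span (v '' X) := by
  have hbij := bijective_algebraMap_cechLoc ha
  constructor
  · rintro ⟨b, -, hb⟩
    have h := congr_fun hb X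
    rw [topCochain_self, cubeD_apply, Finset.sum_apply] at h
    choose s hs using fun k => hbij.2 (wedge a k b X)
    have : algebraMap A (CechLoc a X) (∑ k ∈ X, v k * s k) = algebraMap A (CechLoc a X) r := by
      rw [← h, map_sum]
      refine Finset.sum_congr rfl fun k _ => ?_
      rw [Pi.smul_apply, ← hs, map_mul, Algebra.smul_def]
    rw [← hbij.1 this]
    exact Ideal.sum_mem _ fun k hk =>
      Ideal.mul_mem_right _ _ (Ideal.subset_span ⟨k, hk, rfl⟩)
  · suffices h : Ideal.span (v '' X) ≤ (cubeCob a v ∅ X X.card).comap (topCochain a X) from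
      fun hr => h hr
    rw [Ideal.span_le]
    rintro _ ⟨k, hk, rfl⟩
    have hX : insert k (X.erase k) = X := Finset.insert_erase hk
    have h1 : topCochain a X 1 ∈ cubeSupp a (insert k ∅) (insert k (X.erase k)) X.card := by
      rw [hX]
      exact cubeSupp_mono (by simpa using hk) le_rfl (topCochain_mem a X 1)
    obtain ⟨n, b, hb, hbc⟩ := exists_wedge_eq_pow_smul (Finset.notMem_empty k) h1
    rw [ha k hk, one_pow, one_smul] at hbc
    refine ⟨b, cubeSupp_mono le_rfl (Finset.erase_subset k X) hb, ?_⟩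
    have h0 : cubeD a v (X.erase k) b = 0 := by
      have := cubeD_mem_cubeSupp (w := v) hb
      rw [sub_add_cancel, cubeSupp_eq_bot_of_card_lt] at this
      · exact this
      · exact_mod_cast Finset.card_lt_card (Finset.erase_ssubset hk)
    calc cubeD a v X b = cubeD a v (insert k (X.erase k)) b := by rw [hX]
      _ = v k • topCochain a X 1 := by rw [cubeD_insert (by simp), h0, hbc, add_zero]
      _ = topCochain a X (v k) := by rw [← map_smul, smul_eq_mul, mul_one]

end TopKoszul

/-! ### From cohomological bounds to Frobenius closures. -/

section TestExponent

variable (p : ℕ) [Fact p.Prime] {A : Type*} [CommRing A] [Algebra (ZMod p) A]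

lemma frobPow_span (e : ℕ) (X : Set A) :
    frobPow p e (Ideal.span X) = Ideal.span ((fun x => x ^ p ^ e) '' X) := by
  refine le_antisymm ?_ (Ideal.span_mono (Set.image_mono Ideal.subset_span))
  rw [frobPow, Ideal.span_le]
  rintro _ ⟨r, hr, rfl⟩
  refine Submodule.span_induction
    (p := fun r _ => r ^ p ^ e ∈ Ideal.span ((fun x => x ^ p ^ e) '' X)) ?_ ?_ ?_ ?_ hr
  · exact fun x hx => Ideal.subset_span ⟨x, hx, rfl⟩
  · rw [zero_pow (pow_ne_zero _ (Fact.out : p.Prime).ne_zero)]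
    exact Ideal.zero_mem _
  · intro x y _ _ hx hy
    rw [add_pow_frob]
    exact Ideal.add_mem _ hx hy
  · intro s x _ hx
    rw [smul_eq_mul, mul_pow]
    exact Ideal.mul_mem_left _ _ hx

lemma cubeFrob_topCochain {N : ℕ} (a : Fin N → A) (X : Finset (Fin N)) (m : ℕ) (r : A) :
    cubeFrob p a m (topCochain a X r) = topCochain a X (r ^ p ^ m) := by
  ext T
  rw [cubeFrob_apply]
  by_cases h : T = X
  · subst h
    rw [topCochain_self, topCochain_self, map_pow]
  · rw [topCochain_of_ne a X _ h, topCochain_of_ne a X _ h,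
      zero_pow (pow_ne_zero _ (Fact.out : p.Prime).ne_zero)]

/-- On top Koszul cohomology Frobenius is r ↦ r^{p^m} from A/(w) to A/(w^{p^m}), so nilpotent
elements of A/(w) are exactly classes of the Frobenius closure. -/
lemma pow_mem_of_cubeBd {N : ℕ} {a w : Fin N → A} {X : Finset (Fin N)} (ha : ∀ k ∈ X, a k = 1)
    {h : ℕ} (hbd : CubeBd p a w X X.card h) {r : A}
    (hr : r ∈ frobClosure p (Ideal.span (w '' X))) :
    r ^ p ^ h ∈ frobPow p h (Ideal.span (w '' X)) := by
  have key : ∀ m, cubeFrob p a m (topCochain a X r) ∈ cubeCob a (w ^ p ^ m) ∅ X X.card ↔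
      r ^ p ^ m ∈ frobPow p m (Ideal.span (w '' X)) := by
    intro m
    rw [cubeFrob_topCochain, topCochain_mem_cubeCob_iff ha, frobPow_span, Set.image_image]
    rfl
  have hc := cubeSupp_mono (Finset.empty_subset X) le_rfl (topCochain_mem a X r)
  rw [← key]
  have := hbd 0 (topCochain a X r) hc (by
    have := cubeD_mem_cubeSupp (w := w ^ p ^ 0) hc
    rw [cubeSupp_eq_bot_of_card_lt (by omega)] at this
    exact this)
  simp only [zero_add] at this
  refine this ?_
  obtain ⟨m, hm⟩ := hr
  exact ⟨m, (key m).2 hm⟩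

/-- The Frobenius test exponent of `(x)` is bounded by the Frobenius invariants of the Čech
cohomology of `y`, if `y` lies in the radical of `(x)`. -/
theorem pow_mem_frobPow_of_cech {d n : ℕ} {x : Fin d → A} {y : Fin n → A}
    (hy : ∀ k, y k ∈ (Ideal.span (Set.range x)).radical)
    (hnil : ∀ j : ℕ, j < d → CechNil p y j) {h : ℕ → ℕ}
    (hbd : ∀ j : ℕ, j ≤ d → CechBd p y j (h j)) {r : A}
    (hr : r ∈ frobClosure p (Ideal.span (Set.range x))) :
    r ^ p ^ (∑ j ∈ Finset.range (d + 1), d.choose j * h j) ∈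
      frobPow p (∑ j ∈ Finset.range (d + 1), d.choose j * h j) (Ideal.span (Set.range x)) := by
  -- The first d directions form the Koszul complex of x, the last n the Čech complex of y.
  let a : Fin (d + n) → A := Fin.append 1 y
  let w : Fin (d + n) → A := Fin.append x 1
  let φ : Fin d ↪o Fin (d + n) := Fin.castAddOrderEmb n
  let ψ : Fin n ↪o Fin (d + n) := Fin.natAddOrderEmb d
  let X : Finset (Fin (d + n)) := Finset.univ.map φ.toEmbedding
  let S : Finset (Fin (d + n)) := Finset.univ.map ψ.toEmbedding
  have hψ : ∀ k, w (ψ k) = 1 := fun k => Fin.append_right x 1 k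
  have haψ : y = fun k => a (ψ k) := funext fun k => (Fin.append_right 1 y k).symm
  have haX : ∀ k ∈ X, a k = 1 := by
    intro k hk
    obtain ⟨k, -, rfl⟩ := Finset.mem_map.1 hk
    exact Fin.append_left 1 y k
  have hwX : w '' X = Set.range x := by
    simp only [X, φ, image_castAdd, w, Fin.append_left]
  have hawX : (fun k => a k * w k) '' X = Set.range x := by
    rw [← hwX]
    exact Set.image_congr fun k hk => by rw [haX k hk, one_mul]
  have hcard : X.card = d := by simp [X]
  have hdisj : Disjoint S X := by
    rw [Finset.disjoint_left]
    intro k hk hk'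
    obtain ⟨k, -, rfl⟩ := Finset.mem_map.1 hk
    obtain ⟨l, -, hl⟩ := Finset.mem_map.1 hk'
    have := congr_arg Fin.val (show Fin.castAdd n l = Fin.natAdd d k from hl)
    rw [Fin.val_castAdd, Fin.val_natAdd] at this
    omega
  have hz : ∀ k ∈ S ∪ X, k ∉ X →
      a k ∈ (Ideal.span ((fun k => a k * w k) '' (X : Set (Fin (d + n))))).radical := by
    intro k hk hkX
    rw [hawX]
    obtain ⟨k, -, rfl⟩ := Finset.mem_map.1 ((Finset.mem_union.1 hk).resolve_right hkX)
    have e : a (ψ k) = y k := Fin.append_right 1 y k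
    change a (ψ k) ∈ _
    rw [e]
    exact hy k
  -- In negative degrees the value is arbitrary, since there are no nonzero cochains; in degree d
  -- the final sum only meets degrees from 0 to d.
  let h' : ℤ → ℕ := fun i => h i.toNat
  have hn' : ∀ i < (d : ℤ), CubeNil p a w S i := by
    intro i hi
    rcases lt_or_ge i 0 with h0 | h0
    · exact cubeNil_of_neg p h0
    · lift i to ℕ using h0
      rw [cubeNil_iff_cechNil a ψ p hψ, ← haψ]
      exact hnil i (by exact_mod_cast hi)
  have hb' : ∀ i ≤ (d : ℤ), CubeBd p a w S i (h' i) := by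
    intro i hi
    rcases lt_or_ge i 0 with h0 | h0
    · exact cubeBd_of_neg p h0 _
    · lift i to ℕ using h0
      rw [cubeBd_iff_cechBd a ψ p hψ, ← haψ]
      exact hbd i (by exact_mod_cast hi)
  have H := (cubeNil_and_cubeBd_union p hdisj haX hn' hb').2 d le_rfl
  -- The Čech directions can be dropped because y lies in the radical of (x), which leaves the pure
  -- Koszul complex.
  rw [← cubeBd_iff_of_subset p Finset.subset_union_right hz, hcard] at H
  have hsum : ∑ l ∈ Finset.range (d + 1), d.choose l * h' (d - l) =
      ∑ j ∈ Finset.range (d + 1), d.choose j * h j := by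
    rw [← Finset.sum_flip]
    refine Finset.sum_congr rfl fun l hl => ?_
    have hl : l ≤ d := Nat.lt_succ_iff.1 (Finset.mem_range.1 hl)
    rw [Nat.choose_symm hl]
    congr 1
    change h _ = h l
    congr 1
    omega
  rw [hsum] at H
  rw [← hwX] at hr ⊢
  refine pow_mem_of_cubeBd p haX ?_ hr
  rw [hcard]
  exact H

end TestExponent

/-! ### Parameter ideals of noetherian local rings -/

section Parameters

variable {R : Type*} [CommRing R]

/-- Heights of primes grow by at least one at each strict inclusion, starting from at least the
height of I. -/
lemma height_add_length_le (I : Ideal R) (l : LTSeries (PrimeSpectrum R))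
    (hl : I ≤ l.head.asIdeal) : I.height + l.length ≤ l.last.asIdeal.height := by
  have key : ∀ (i : ℕ) (hi : i < l.length + 1), I.height + i ≤ (l ⟨i, hi⟩).asIdeal.height := by
    intro i
    induction i with
    | zero => exact fun hi => by simpa using! Ideal.height_mono hl
    | succ i ih =>
      intro hi
      have h1 := ih (by omega)
      have hlt : l ⟨i, by omega⟩ < l ⟨i + 1, hi⟩ :=
        l.strictMono (Fin.mk_lt_mk.2 (Nat.lt_succ_self i))
      have h2 := Ideal.height_add_one_le_of_lt_of_isPrime (I := (l ⟨i, by omega⟩).asIdeal)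
        (J := (l ⟨i + 1, hi⟩).asIdeal) hlt
      calc I.height + ((i + 1 : ℕ) : ℕ∞) = I.height + i + 1 := by push_cast; rw [add_assoc]
        _ ≤ _ := (add_le_add_left h1 1).trans h2
  exact key l.length (Nat.lt_succ_self _)

lemma ringKrullDim_quotient_le_of_height_eq {I : Ideal R} {t s : ℕ} (ht : I.height = t)
    (hd : ringKrullDim R ≤ ((t + s : ℕ) : WithBot ℕ∞)) :
    ringKrullDim (R ⧸ I) ≤ (s : WithBot ℕ∞) := by
  rw [ringKrullDim_quotient, Order.krullDim]
  refine iSup_le fun l => ?_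
  have h1 := height_add_length_le I (l.map Subtype.val (fun _ _ h => h))
    (l.head.2)
  have h2 := (Ideal.height_le_ringKrullDim_of_isPrime
    (I := (l.map Subtype.val (fun _ _ h => h)).last.asIdeal)).trans hd
  rw [ht] at h1
  have h3 : ((t : ℕ∞) + (l.length : ℕ∞)) ≤ ((t + s : ℕ) : ℕ∞) := by
    have := (WithBot.coe_le_coe.2 h1).trans h2
    exact WithBot.coe_le_coe.1 this
  have h4 : t + l.length ≤ t + s := by exact_mod_cast h3
  have h5 : l.length ≤ s := by omega
  exact_mod_cast h5

variable [IsLocalRing R] [IsNoetherianRing R]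

open IsLocalRing

lemma exists_maximalIdeal_le_radical_of_dim_le {s : ℕ}
    (hd : ringKrullDim R ≤ (s : WithBot ℕ∞)) :
    ∃ z : Fin s → R, (∀ k, z k ∈ maximalIdeal R) ∧
      maximalIdeal R ≤ (Ideal.span (Set.range z)).radical := by
  obtain ⟨S, hS, hcard⟩ := Ideal.exists_finset_card_eq_height_of_isNoetherianRing (maximalIdeal R)
  have hcard' : S.card ≤ s := by
    rw [← maximalIdeal_height_eq_ringKrullDim, ← hcard] at hd
    exact_mod_cast hd
  have hmem : ∀ r ∈ S, r ∈ maximalIdeal R := fun r hr => hS.1.2 (Ideal.subset_span hr)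
  -- The height of the maximal ideal may be smaller than s; the sequence is padded with zeros.
  let z : Fin s → R := fun k => if h : k.1 < S.card then S.equivFin.symm ⟨k.1, h⟩ else 0
  refine ⟨z, fun k => ?_, ?_⟩
  · by_cases h : k.1 < S.card
    · simp only [z, dif_pos h]; exact hmem _ (Subtype.prop _)
    · simp only [z, dif_neg h]; exact Ideal.zero_mem _
  · have hle : Ideal.span (S : Set R) ≤ Ideal.span (Set.range z) := by
      refine Ideal.span_mono fun r hr => ?_
      let k := S.equivFin ⟨r, hr⟩
      refine ⟨⟨k.1, k.2.trans_le hcard'⟩, ?_⟩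
      simp only [z, dif_pos k.2, Fin.eta, k, Equiv.symm_apply_apply]
    refine le_trans ?_ (Ideal.radical_mono hle)
    rw [Ideal.radical_eq_sInf]
    refine le_sInf fun J hJ => ?_
    have := hJ.2
    exact hS.2 ⟨hJ.2, hJ.1⟩ (le_maximalIdeal this.ne_top)

omit [IsLocalRing R] [IsNoetherianRing R] in
lemma mk_mem_radical_span {I : Ideal R} {n : ℕ} {z : Fin n → R} {r : R}
    (h : Ideal.Quotient.mk I r ∈
      (Ideal.span (Set.range fun k => Ideal.Quotient.mk I (z k))).radical) :
    r ∈ (I ⊔ Ideal.span (Set.range z)).radical := by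
  obtain ⟨m, hm⟩ := h
  refine ⟨m, ?_⟩
  rw [show (Set.range fun k => Ideal.Quotient.mk I (z k)) = Ideal.Quotient.mk I '' Set.range z from
    Set.range_comp _ _, ← Ideal.map_span, ← map_pow] at hm
  obtain ⟨u, hu, hur⟩ := (Ideal.mem_map_iff_of_surjective _ Ideal.Quotient.mk_surjective).1 hm
  rw [← sub_add_cancel (r ^ m) u]
  exact Submodule.add_mem_sup (Ideal.Quotient.eq.1 hur.symm) hu

/-- A parameter ideal is generated by a part of a system of parameters. -/
lemma exists_systemOfParameters {d : ℕ} (hdim : ringKrullDim R = d) {q : Ideal R}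
    (hq : IsParameterIdeal q) :
    ∃ (t s : ℕ) (x : Fin t → R) (z : Fin s → R), t + s = d ∧ Ideal.span (Set.range x) = q ∧
      (∀ k, x k ∈ maximalIdeal R) ∧ (∀ k, z k ∈ maximalIdeal R) ∧
      maximalIdeal R ≤ (Ideal.span (Set.range x) ⊔ Ideal.span (Set.range z)).radical := by
  have hqtop : q ≠ ⊤ := by
    rintro rfl
    rw [IsParameterIdeal, Ideal.height_top] at hq
    exact ENat.natCast_ne_top _ hq.symm
  have hqm := le_maximalIdeal hqtop
  have hle : q.spanFinrank ≤ d := by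
    have := Ideal.height_le_ringKrullDim_of_ne_top hqtop
    rw [hdim, hq] at this
    exact_mod_cast this
  obtain ⟨s, rfl⟩ := Nat.exists_eq_add_of_le hle
  have : Nontrivial (R ⧸ q) := Ideal.Quotient.nontrivial_iff.2 hqtop
  have hloc : IsLocalRing (R ⧸ q) :=
    IsLocalRing.of_surjective' (Ideal.Quotient.mk q) Ideal.Quotient.mk_surjective
  obtain ⟨z', hz', hrad⟩ := exists_maximalIdeal_le_radical_of_dim_le
    (ringKrullDim_quotient_le_of_height_eq hq hdim.le)
  choose z hz using fun k => Ideal.Quotient.mk_surjective (z' k)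
  obtain rfl : (fun k => Ideal.Quotient.mk q (z k)) = z' := funext hz
  have hmax : ∀ r, Ideal.Quotient.mk q r ∈ maximalIdeal (R ⧸ q) ↔ r ∈ maximalIdeal R := by
    intro r
    have : IsLocalHom (Ideal.Quotient.mk q) := .of_surjective _ Ideal.Quotient.mk_surjective
    rw [← maximalIdeal_comap (Ideal.Quotient.mk q), Ideal.mem_comap]
  obtain ⟨S, hcard, hS⟩ : ∃ S : Finset R, S.card = q.spanFinrank ∧ Ideal.span (S : Set R) = q :=
    (IsNoetherian.noetherian q).exists_span_finset_card_eq_spanFinrank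
  let E : S ≃ Fin q.spanFinrank := S.equivFinOfCardEq hcard
  have hx : Set.range (fun k => (E.symm k : R)) = S := by
    ext r
    constructor
    · rintro ⟨k, rfl⟩; exact Subtype.prop _
    · intro hr; exact ⟨E ⟨r, hr⟩, by simp⟩
  have hSq : ∀ r ∈ S, r ∈ q := fun r hr => by
    rw [← hS]; exact Ideal.subset_span hr
  refine ⟨q.spanFinrank, s, fun k => E.symm k, z, rfl, by rw [hx, hS],
    fun k => hqm (hSq _ (Subtype.prop _)), fun k => (hmax _).1 (hz' k),
    fun r hr => ?_⟩
  rw [hx, hS]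
  exact mk_mem_radical_span (hrad ((hmax r).2 hr))

/-- Krull's intersection theorem in R/I. -/
lemma mem_of_forall_mem_sup_pow {I : Ideal R} {r : R}
    (h : ∀ n : ℕ, r ∈ I ⊔ maximalIdeal R ^ n) : r ∈ I := by
  rw [← Ideal.Quotient.eq_zero_iff_mem]
  have := Ideal.iInf_pow_smul_eq_bot_of_isLocalRing (M := R ⧸ I) (maximalIdeal R)
    (maximalIdeal.isMaximal R).ne_top
  rw [← Submodule.mem_bot R, ← this, Submodule.mem_iInf]
  intro n
  obtain ⟨u, hu, v, hv, rfl⟩ := Submodule.mem_sup.1 (h n)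
  rw [map_add, Ideal.Quotient.eq_zero_iff_mem.2 hu, zero_add]
  have : Ideal.Quotient.mk I v = v • (1 : R ⧸ I) := by
    rw [Algebra.smul_def, mul_one]; rfl
  rw [this]
  exact Submodule.smul_mem_smul hv trivial

variable (p : ℕ) [Fact p.Prime] [Algebra (ZMod p) R]

omit [IsLocalRing R] [IsNoetherianRing R] in
lemma frobClosure_mono {I J : Ideal R} (h : I ≤ J) : frobClosure p I ≤ frobClosure p J := by
  rintro r ⟨e, he⟩
  exact ⟨e, Ideal.span_mono (Set.image_mono h) he⟩

omit [IsLocalRing R] [IsNoetherianRing R] in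
lemma le_frobClosure (I : Ideal R) : I ≤ frobClosure p I := by
  intro r hr
  exact ⟨0, Ideal.subset_span ⟨r, hr, rfl⟩⟩

omit [CommRing R] [IsLocalRing R] [IsNoetherianRing R] in
lemma range_append {t s : ℕ} (x : Fin t → R) (z : Fin s → R) :
    Set.range (Fin.append x z) = Set.range x ∪ Set.range z := by
  ext r
  simp only [Set.mem_union, Set.mem_range]
  constructor
  · rintro ⟨k, rfl⟩
    refine Fin.addCases (fun k => Or.inl ⟨k, by simp⟩) (fun k => Or.inr ⟨k, by simp⟩) k
  · rintro (⟨k, rfl⟩ | ⟨k, rfl⟩)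
    · exact ⟨_, Fin.append_left x z k⟩
    · exact ⟨_, Fin.append_right x z k⟩

/-- The uniform bound of Frobenius test exponents of a weakly `F`-nilpotent local ring. -/
theorem fte_le_sum {d : ℕ} (hdim : ringKrullDim R = d) {n : ℕ} {y : Fin n → R}
    (hy : ∀ k, y k ∈ maximalIdeal R) (hnil : ∀ j : ℕ, j < d → CechNil p y j) {h : ℕ → ℕ}
    (hbd : ∀ j : ℕ, j ≤ d → CechBd p y j (h j)) :
    fte p R ≤ ((∑ j ∈ Finset.range (d + 1), d.choose j * h j : ℕ) : ℕ∞) := by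
  set H := ∑ j ∈ Finset.range (d + 1), d.choose j * h j with hH
  refine iSup₂_le fun q hq => ?_
  suffices h : frobPow p H (frobClosure p q) = frobPow p H q from
    iInf₂_le (f := fun (e : ℕ) (_ : frobPow p e (frobClosure p q) = frobPow p e q) => (e : ℕ∞)) H h
  refine le_antisymm ?_ ?_
  · obtain ⟨t, s, x, z, rfl, rfl, hx, hz, hrad⟩ := exists_systemOfParameters hdim hq
    rw [frobPow, Ideal.span_le]
    rintro _ ⟨r, hr, rfl⟩
    refine mem_of_forall_mem_sup_pow fun m => ?_
    -- A full sequence of length t + s still generates an ideal with radical containing 𝔪, so the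
    -- exponent H works for it independently of m. The added part is later absorbed into 𝔪^m.
    let x' : Fin (t + s) → R := Fin.append x fun k => z k ^ (m + 1)
    have hx' : Ideal.span (Set.range x') =
        Ideal.span (Set.range x) ⊔ Ideal.span (Set.range fun k => z k ^ (m + 1)) := by
      rw [range_append, Ideal.span_union]
    have hrad' : maximalIdeal R ≤ (Ideal.span (Set.range x')).radical := by
      refine hrad.trans ?_
      rw [Ideal.radical_le_radical_iff, sup_le_iff, Ideal.span_le, Ideal.span_le, hx']
      refine ⟨?_, ?_⟩
      · rintro _ ⟨k, rfl⟩
        exact Ideal.le_radical (Ideal.mem_sup_left (Ideal.subset_span ⟨k, rfl⟩))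
      · rintro _ ⟨k, rfl⟩
        exact ⟨m + 1, Ideal.mem_sup_right (Ideal.subset_span ⟨k, rfl⟩)⟩
    have key := pow_mem_frobPow_of_cech p (x := x') (fun k => hrad' (hy k)) hnil hbd
      (frobClosure_mono p (by rw [hx']; exact le_sup_left) hr)
    rw [← hH, frobPow_span, range_append, Set.image_union, Ideal.span_union,
      ← frobPow_span] at key
    refine SetLike.le_def.1 (sup_le_sup le_rfl ?_) key
    rw [Ideal.span_le]
    rintro _ ⟨_, ⟨k, rfl⟩, rfl⟩
    simp only [← pow_mul]
    refine Ideal.pow_le_pow_right ?_ (Ideal.pow_mem_pow (hz k) _)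
    exact (Nat.le_succ m).trans (Nat.le_mul_of_pos_right _
      (pow_pos (Fact.out : p.Prime).pos _))
  · exact Ideal.span_mono (Set.image_mono (le_frobClosure p q))

end Parameters

/-! ### The long exact sequence of a gluing -/

section LocMap

variable {A B C : Type*} [CommRing A] [CommRing B] [CommRing C]

/-- The map `A_g → B_{g'}` induced by a ring homomorphism `f` with `g' = f g`. -/
def locMap (f : A →+* B) {g : A} {g' : B} (h : g' = f g) :
    Localization.Away g →+* Localization.Away g' :=
  IsLocalization.Away.lift g (g := (algebraMap B (Localization.Away g')).comp f) (by
    rw [RingHom.comp_apply, ← h]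
    exact IsLocalization.Away.algebraMap_isUnit g')

lemma locMap_algebraMap (f : A →+* B) {g : A} {g' : B} (h : g' = f g) (r : A) :
    locMap f h (algebraMap A _ r) = algebraMap B _ (f r) :=
  IsLocalization.Away.lift_eq g _ r

lemma locMap_awayRes (f : A →+* B) {g k : A} {g' k' : B} (hg : g' = f g) (hk : k' = f k)
    (h : g ∣ k) (h' : g' ∣ k') (z : Localization.Away g) :
    locMap f hk (awayRes h z) = awayRes h' (locMap f hg z) := by
  have : (locMap f hk).comp (awayRes h).toRingHom = (awayRes h').toRingHom.comp (locMap f hg) := by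
    refine IsLocalization.ringHom_ext (Submonoid.powers g) ?_
    ext r
    change locMap f hk (awayRes h (algebraMap A _ r)) =
      awayRes h' (locMap f hg (algebraMap A _ r))
    rw [awayRes_algebraMap, locMap_algebraMap, locMap_algebraMap, awayRes_algebraMap]
  exact DFunLike.congr_fun this z

lemma locMap_locMap (f : A →+* B) (f' : B →+* C) {g : A} {g' : B} {g'' : C} (h : g' = f g)
    (h' : g'' = f' g') (h'' : g'' = (f'.comp f) g) (z : Localization.Away g) :
    locMap f' h' (locMap f h z) = locMap (f'.comp f) h'' z := by
  have : (locMap f' h').comp (locMap f h) = locMap (f'.comp f) h'' := by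
    refine IsLocalization.ringHom_ext (Submonoid.powers g) ?_
    ext r
    change locMap f' h' (locMap f h (algebraMap A _ r)) = locMap (f'.comp f) h'' (algebraMap A _ r)
    rw [locMap_algebraMap, locMap_algebraMap, locMap_algebraMap]
    rfl
  exact DFunLike.congr_fun this z

lemma exists_away_mul_eq {g : A} (m : ℕ) (r : A) :
    ∃ z : Localization.Away g, z * algebraMap A _ g ^ m = algebraMap A _ r := by
  obtain ⟨v, hv⟩ := (IsLocalization.Away.algebraMap_isUnit (S := Localization.Away g) g).pow m
  exact ⟨algebraMap A _ r * ↑v⁻¹, by rw [← hv, mul_assoc, Units.inv_mul, mul_one]⟩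

lemma away_mul_right_cancel {g : A} (m : ℕ) {z z' : Localization.Away g}
    (h : z * algebraMap A _ g ^ m = z' * algebraMap A _ g ^ m) : z = z' :=
  ((IsLocalization.Away.algebraMap_isUnit (S := Localization.Away g) g).pow m).mul_right_cancel h

lemma locMap_surjective {f : A →+* B} (hf : Function.Surjective f) {g : A} {g' : B}
    (h : g' = f g) : Function.Surjective (locMap f h) := by
  intro z
  obtain ⟨m, b, hb⟩ := IsLocalization.Away.surj g' z
  obtain ⟨r, rfl⟩ := hf b
  obtain ⟨w, hw⟩ := exists_away_mul_eq (g := g) m r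
  refine ⟨w, away_mul_right_cancel m ?_⟩
  rw [hb, ← locMap_algebraMap f h, ← hw, map_mul, map_pow, locMap_algebraMap,
    congr_arg (algebraMap B (Localization.Away g')) h.symm]

lemma exists_of_locMap_eq_zero {f : A →+* B} {g : A} {g' : B} (h : g' = f g)
    {z : Localization.Away g} (hz : locMap f h z = 0) :
    ∃ (M : ℕ), ∀ m, M ≤ m → ∃ r, f r = 0 ∧ z * algebraMap A _ g ^ m = algebraMap A _ r := by
  obtain ⟨m, r, hr⟩ := IsLocalization.Away.surj g z
  have h0 : algebraMap B (Localization.Away g') (f r) = 0 := by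
    rw [← locMap_algebraMap f h, ← hr, map_mul, hz, zero_mul]
  obtain ⟨⟨_, k, rfl⟩, hk⟩ := (IsLocalization.map_eq_zero_iff (Submonoid.powers g') _ _).1 h0
  refine ⟨m + k, fun l hl => ?_⟩
  obtain ⟨t, rfl⟩ := Nat.exists_eq_add_of_le hl
  refine ⟨g ^ (k + t) * r, ?_, ?_⟩
  · simp only at hk
    rw [map_mul, map_pow, ← h, pow_add, mul_right_comm, hk, zero_mul]
  · rw [map_mul, map_pow, ← hr]
    ring

end LocMap

/-! ### Functoriality of the Čech complex. -/

section CechMap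

variable {A B C : Type*} [CommRing A] [CommRing B] [CommRing C] {n : ℕ}
  {x : Fin n → A} {y : Fin n → B} {z : Fin n → C}

lemma prod_eq_map_prod {f : A →+* B} (h : ∀ k, y k = f (x k)) (T : Finset (Fin n)) :
    ∏ k ∈ T, y k = f (∏ k ∈ T, x k) := by
  rw [map_prod]
  exact Finset.prod_congr rfl fun k _ => h k

/-- The map of Čech complexes induced by a ring homomorphism. -/
def cechMap (f : A →+* B) (h : ∀ k, y k = f (x k)) (j : ℤ) : Cech x j →+ Cech y j where
  toFun c := fun T => locMap f (prod_eq_map_prod h T.1) (c T)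
  map_zero' := funext fun _ => map_zero _
  map_add' c c' := funext fun T => map_add _ (c T) (c' T)

lemma cechMap_apply (f : A →+* B) (h : ∀ k, y k = f (x k)) (j : ℤ) (c : Cech x j) (T) :
    cechMap f h j c T = locMap f (prod_eq_map_prod h T.1) (c T) := rfl

lemma cechD_cechMap (f : A →+* B) (h : ∀ k, y k = f (x k)) (i j : ℤ) (c : Cech x i) :
    cechD y i j (cechMap f h i c) = cechMap f h j (cechD x i j c) := by
  ext T
  rw [cechMap_apply]
  simp only [cechD, LinearMap.pi_apply, LinearMap.sum_apply, LinearMap.smul_apply, map_sum,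
    map_zsmul]
  refine Finset.sum_congr rfl fun k _ => ?_
  congr 1
  split_ifs with hk
  · exact (locMap_awayRes f (prod_eq_map_prod h _) (prod_eq_map_prod h _)
      (Finset.prod_dvd_prod_of_subset _ _ x (T.1.erase_subset k.1))
      (Finset.prod_dvd_prod_of_subset _ _ y (T.1.erase_subset k.1)) _).symm
  · simp

lemma cechMap_cechMap (f : A →+* B) (f' : B →+* C) (h : ∀ k, y k = f (x k))
    (h' : ∀ k, z k = f' (y k)) (h'' : ∀ k, z k = (f'.comp f) (x k)) (j : ℤ) (c : Cech x j) :
    cechMap f' h' j (cechMap f h j c) = cechMap (f'.comp f) h'' j c := by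
  ext T
  exact locMap_locMap f f' (prod_eq_map_prod h _) (prod_eq_map_prod h' _)
    (prod_eq_map_prod h'' _) _

lemma cechMap_surjective {f : A →+* B} (hf : Function.Surjective f) (h : ∀ k, y k = f (x k))
    (j : ℤ) : Function.Surjective (cechMap f h j) := by
  intro c
  refine ⟨fun T => (locMap_surjective hf (prod_eq_map_prod h T.1) (c T)).choose, ?_⟩
  ext T
  rw [cechMap_apply]
  exact (locMap_surjective hf (prod_eq_map_prod h T.1) (c T)).choose_spec

lemma cechMap_cechPow (p : ℕ) [Fact p.Prime] [Algebra (ZMod p) A] [Algebra (ZMod p) B]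
    (f : A →+* B) (h : ∀ k, y k = f (x k)) (j : ℤ) (m : ℕ) (c : Cech x j) :
    cechMap f h j (cechPow p x j m c) = cechPow p y j m (cechMap f h j c) := by
  ext T
  exact map_pow (locMap f (prod_eq_map_prod h T.1)) (c T) (p ^ m)

lemma cechD_cechD {i j k : ℤ} (hj : j = i + 1) (hk : k = j + 1) (c : Cech x i) :
    cechD x j k (cechD x i j c) = 0 := by
  let φ : Fin n ↪o Fin n := RelEmbedding.refl _
  obtain ⟨c, -, rfl⟩ := exists_cubeToCech_eq x φ c
  have h1 := cubeToCech_cubeD x φ hj (w := 1) (fun _ => rfl) c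
  have h2 := cubeToCech_cubeD x φ hk (w := 1) (fun _ => rfl)
    (cubeD x 1 (Finset.univ.map φ.toEmbedding) c)
  rw [cubeD_cubeD, map_zero, h1] at h2
  exact h2.symm

lemma cechD_eq_zero_congr {i j j' : ℤ} (h : j = j') {c : Cech x i} (hc : cechD x i j c = 0) :
    cechD x i j' c = 0 := by
  subst h; exact hc

end CechMap

/-! ### Cartesian squares and their connecting map. -/

section Glue

variable {A B₁ B₂ C : Type*} [CommRing A] [CommRing B₁] [CommRing B₂] [CommRing C]

/-- A cartesian square of surjective ring homomorphisms. -/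
structure IsGluing (f₁ : A →+* B₁) (f₂ : A →+* B₂) (g₁ : B₁ →+* C) (g₂ : B₂ →+* C) : Prop where
  comm : g₁.comp f₁ = g₂.comp f₂
  surj₁ : Function.Surjective f₁
  surj₂ : Function.Surjective f₂
  surj : Function.Surjective g₁
  inj : ∀ r, f₁ r = 0 → f₂ r = 0 → r = 0
  exact : ∀ r, g₁ (f₁ r) = 0 → ∃ s t, f₁ s = 0 ∧ f₂ t = 0 ∧ r = s + t

variable {f₁ : A →+* B₁} {f₂ : A →+* B₂} {g₁ : B₁ →+* C} {g₂ : B₂ →+* C}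
  (G : IsGluing f₁ f₂ g₁ g₂)
include G

lemma IsGluing.locMap_inj {g : A} {u₁ : B₁} {u₂ : B₂} (h₁ : u₁ = f₁ g) (h₂ : u₂ = f₂ g)
    {z : Localization.Away g} (hz₁ : locMap f₁ h₁ z = 0) (hz₂ : locMap f₂ h₂ z = 0) : z = 0 := by
  obtain ⟨M₁, H₁⟩ := exists_of_locMap_eq_zero h₁ hz₁
  obtain ⟨M₂, H₂⟩ := exists_of_locMap_eq_zero h₂ hz₂
  obtain ⟨r, hr, hzr⟩ := H₁ M₁ le_rfl
  have h0 : locMap f₂ h₂ (algebraMap A _ r) = 0 := by rw [← hzr, map_mul, hz₂, zero_mul]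
  rw [locMap_algebraMap] at h0
  obtain ⟨⟨_, k, rfl⟩, hk⟩ := (IsLocalization.map_eq_zero_iff (Submonoid.powers u₂) _ _).1 h0
  have h3 : g ^ k * r = 0 := by
    refine G.inj _ (by rw [map_mul, hr, mul_zero]) ?_
    rw [map_mul, map_pow, ← h₂]
    exact hk
  refine away_mul_right_cancel (M₁ + k) ?_
  rw [pow_add, ← mul_assoc, hzr, ← map_pow, ← map_mul, mul_comm, h3, map_zero, zero_mul]

/-- Lift both elements to A_g. Their difference dies over C, so after clearing denominators it is a
sum of elements of ker f₁ and ker f₂. Moving the first summand to the first lift makes the two lifts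
agree up to an element of ker f₂. -/
lemma IsGluing.exists_locMap {g : A} {u₁ : B₁} {u₂ : B₂} {u : C} (h₁ : u₁ = f₁ g)
    (h₂ : u₂ = f₂ g) (hu₁ : u = g₁ u₁) (hu₂ : u = g₂ u₂) {z₁ : Localization.Away u₁}
    {z₂ : Localization.Away u₂} (hz : locMap g₁ hu₁ z₁ = locMap g₂ hu₂ z₂) :
    ∃ z, locMap f₁ h₁ z = z₁ ∧ locMap f₂ h₂ z = z₂ := by
  obtain ⟨w₁, rfl⟩ := locMap_surjective G.surj₁ h₁ z₁
  obtain ⟨w₂, rfl⟩ := locMap_surjective G.surj₂ h₂ z₂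
  have hu : u = (g₁.comp f₁) g := by rw [hu₁, h₁]; rfl
  have hu' : u = (g₂.comp f₂) g := by rw [hu₂, h₂]; rfl
  have hw : locMap (g₁.comp f₁) hu (w₁ - w₂) = 0 := by
    rw [locMap_locMap _ _ _ _ hu, locMap_locMap _ _ _ _ hu'] at hz
    have e : locMap (g₂.comp f₂) hu' w₂ = locMap (g₁.comp f₁) hu w₂ := by
      congr 2
      exact G.comm.symm
    rw [map_sub, hz, e, sub_self]
  obtain ⟨M, H⟩ := exists_of_locMap_eq_zero hu hw
  obtain ⟨r, hr, hwr⟩ := H M le_rfl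
  obtain ⟨s, t, hs, ht, rfl⟩ := G.exact r hr
  obtain ⟨σ, hσ⟩ := exists_away_mul_eq (g := g) M s
  obtain ⟨τ, hτ⟩ := exists_away_mul_eq (g := g) M t
  have hσ0 : locMap f₁ h₁ σ = 0 := by
    refine away_mul_right_cancel M ?_
    have := congr_arg (locMap f₁ h₁) hσ
    rw [map_mul, map_pow, locMap_algebraMap, locMap_algebraMap, hs, map_zero, ← h₁] at this
    rw [this, zero_mul]
  have hτ0 : locMap f₂ h₂ τ = 0 := by
    refine away_mul_right_cancel M ?_
    have := congr_arg (locMap f₂ h₂) hτ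
    rw [map_mul, map_pow, locMap_algebraMap, locMap_algebraMap, ht, map_zero, ← h₂] at this
    rw [this, zero_mul]
  have hw12 : w₁ - w₂ = σ + τ := by
    refine away_mul_right_cancel M ?_
    rw [hwr, add_mul, hσ, hτ, map_add]
  refine ⟨w₁ - σ, by rw [map_sub, hσ0, sub_zero], ?_⟩
  rw [show w₁ - σ = w₂ + τ by linear_combination hw12, map_add, hτ0, add_zero]

variable {n : ℕ} {x : Fin n → A} {x₁ : Fin n → B₁} {x₂ : Fin n → B₂} {y : Fin n → C}
  (h₁ : ∀ k, x₁ k = f₁ (x k)) (h₂ : ∀ k, x₂ k = f₂ (x k)) (k₁ : ∀ k, y k = g₁ (x₁ k))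
  (k₂ : ∀ k, y k = g₂ (x₂ k))

lemma IsGluing.cechMap_inj {j : ℤ} {c : Cech x j} (hc₁ : cechMap f₁ h₁ j c = 0)
    (hc₂ : cechMap f₂ h₂ j c = 0) : c = 0 := by
  ext T
  refine G.locMap_inj (prod_eq_map_prod h₁ T.1) (prod_eq_map_prod h₂ T.1) ?_ ?_
  · rw [← cechMap_apply f₁ h₁, hc₁]; rfl
  · rw [← cechMap_apply f₂ h₂, hc₂]; rfl

lemma IsGluing.exists_cechMap {j : ℤ} {c₁ : Cech x₁ j} {c₂ : Cech x₂ j}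
    (hc : cechMap g₁ k₁ j c₁ = cechMap g₂ k₂ j c₂) :
    ∃ c, cechMap f₁ h₁ j c = c₁ ∧ cechMap f₂ h₂ j c = c₂ := by
  have key : ∀ T : {T : Finset (Fin n) // (T.card : ℤ) = j}, ∃ z : CechLoc x T.1,
      locMap f₁ (prod_eq_map_prod h₁ T.1) z = c₁ T ∧
      locMap f₂ (prod_eq_map_prod h₂ T.1) z = c₂ T := fun T =>
    G.exists_locMap (prod_eq_map_prod h₁ T.1) (prod_eq_map_prod h₂ T.1)
      (prod_eq_map_prod k₁ T.1) (prod_eq_map_prod k₂ T.1)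
      (by rw [← cechMap_apply g₁ k₁, hc, cechMap_apply])
  refine ⟨fun T => (key T).choose, ?_, ?_⟩
  · ext T
    rw [cechMap_apply]
    exact (key T).choose_spec.1
  · ext T
    rw [cechMap_apply]
    exact (key T).choose_spec.2

include k₁ k₂ in
/-- The connecting homomorphism of a gluing, with its Frobenius. -/
lemma IsGluing.exists_cocycle (p : ℕ) [Fact p.Prime] [Algebra (ZMod p) A] [Algebra (ZMod p) B₁]
    [Algebra (ZMod p) B₂] [Algebra (ZMod p) C] {j : ℤ} {c : Cech x j} {m : ℕ}
    (hb₁ : ∃ b, cechD x₁ (j - 1) j b = cechPow p x₁ j m (cechMap f₁ h₁ j c))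
    (hb₂ : ∃ b, cechD x₂ (j - 1) j b = cechPow p x₂ j m (cechMap f₂ h₂ j c)) :
    ∃ β : Cech y (j - 1), cechD y (j - 1) (j - 1 + 1) β = 0 ∧
      ∀ m', (∃ b, cechD y (j - 1 - 1) (j - 1) b = cechPow p y (j - 1) m' β) →
        ∃ b, cechD x (j - 1) j b = cechPow p x j (m + m') c := by
  obtain ⟨b₁, hb₁⟩ := hb₁
  obtain ⟨b₂, hb₂⟩ := hb₂
  have kc₁ : ∀ k, y k = (g₁.comp f₁) (x k) := fun k => by rw [k₁, h₁]; rfl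
  have kc₂ : ∀ k, y k = (g₂.comp f₂) (x k) := fun k => by rw [k₂, h₂]; rfl
  have hcomm : ∀ (i : ℤ) (c : Cech x i),
      cechMap g₁ k₁ i (cechMap f₁ h₁ i c) = cechMap g₂ k₂ i (cechMap f₂ h₂ i c) := by
    intro i c
    rw [cechMap_cechMap _ _ _ _ kc₁, cechMap_cechMap _ _ _ _ kc₂]
    congr 2
    exact G.comm
  -- The snake: both differentials are images of the same Frobenius power of c, so the difference
  -- over C is a cocycle.
  refine ⟨cechMap g₁ k₁ _ b₁ - cechMap g₂ k₂ _ b₂,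
    cechD_eq_zero_congr (sub_add_cancel j 1).symm ?_, ?_⟩
  · rw [map_sub, cechD_cechMap, cechD_cechMap, hb₁, hb₂, cechMap_cechPow, cechMap_cechPow, hcomm,
      sub_self]
  rintro m' ⟨γ, hγ⟩
  obtain ⟨γ, rfl⟩ := cechMap_surjective G.surj k₁ _ γ
  rw [cechD_cechMap, map_sub, ← cechMap_cechPow, ← cechMap_cechPow] at hγ
  -- Correcting by the differential of a lift of γ makes the two bounding cochains agree over C
  -- without changing their differentials, so they glue to a cochain on A.
  let b₁' := cechPow p x₁ (j - 1) m' b₁ - cechD x₁ (j - 1 - 1) (j - 1) γ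
  have hdb₁ : cechD x₁ (j - 1) j b₁' = cechMap f₁ h₁ j (cechPow p x j (m + m') c) := by
    simp only [b₁']
    rw [map_sub, cechD_cechD (sub_add_cancel _ 1).symm (sub_add_cancel _ 1).symm, cechD_cechPow,
      hb₁, cechPow_cechPow, cechMap_cechPow, sub_zero]
  have hdb₂ : cechD x₂ (j - 1) j (cechPow p x₂ (j - 1) m' b₂) =
      cechMap f₂ h₂ j (cechPow p x j (m + m') c) := by
    rw [cechD_cechPow, hb₂, cechPow_cechPow, cechMap_cechPow]
  have heq : cechMap g₁ k₁ _ b₁' = cechMap g₂ k₂ _ (cechPow p x₂ (j - 1) m' b₂) := by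
    simp only [b₁']
    rw [map_sub, hγ]
    abel
  obtain ⟨b, e₁, e₂⟩ := G.exists_cechMap h₁ h₂ k₁ k₂ heq
  refine ⟨b, sub_eq_zero.1 (G.cechMap_inj h₁ h₂ ?_ ?_)⟩
  · rw [map_sub, ← cechD_cechMap, e₁, hdb₁, sub_self]
  · rw [map_sub, ← cechD_cechMap, e₂, hdb₂, sub_self]

end Glue

/-! ### Nilpotence and HSL bounds along a gluing. -/

section GlueInvariants

variable (p : ℕ) [Fact p.Prime] {A B₁ B₂ C : Type*} [CommRing A] [CommRing B₁] [CommRing B₂]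
  [CommRing C] [Algebra (ZMod p) A] [Algebra (ZMod p) B₁] [Algebra (ZMod p) B₂]
  [Algebra (ZMod p) C] {f₁ : A →+* B₁} {f₂ : A →+* B₂} {g₁ : B₁ →+* C} {g₂ : B₂ →+* C}
  (G : IsGluing f₁ f₂ g₁ g₂) {n : ℕ} {x : Fin n → A} {x₁ : Fin n → B₁} {x₂ : Fin n → B₂}
  {y : Fin n → C} (h₁ : ∀ k, x₁ k = f₁ (x k)) (h₂ : ∀ k, x₂ k = f₂ (x k))
  (k₁ : ∀ k, y k = g₁ (x₁ k)) (k₂ : ∀ k, y k = g₂ (x₂ k)) {j : ℤ}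

lemma exists_cob_cechMap {A B : Type*} [CommRing A] [CommRing B] [Algebra (ZMod p) A]
    [Algebra (ZMod p) B] {x : Fin n → A} {y : Fin n → B} (f : A →+* B) (h : ∀ k, y k = f (x k))
    {m : ℕ} {c : Cech x j} (hc : ∃ b, cechD x (j - 1) j b = cechPow p x j m c) :
    ∃ b, cechD y (j - 1) j b = cechPow p y j m (cechMap f h j c) := by
  obtain ⟨b, hb⟩ := hc
  exact ⟨cechMap f h (j - 1) b, by rw [cechD_cechMap, hb, cechMap_cechPow]⟩

lemma exists_cob_of_le {A : Type*} [CommRing A] [Algebra (ZMod p) A] {x : Fin n → A} {m m' : ℕ}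
    (hm : m ≤ m') {c : Cech x j} (hc : ∃ b, cechD x (j - 1) j b = cechPow p x j m c) :
    ∃ b, cechD x (j - 1) j b = cechPow p x j m' c := by
  obtain ⟨b, hb⟩ := hc
  refine ⟨cechPow p x (j - 1) (m' - m) b, ?_⟩
  rw [cechD_cechPow, hb, cechPow_cechPow, Nat.add_sub_cancel' hm]

include G h₁ h₂ k₁ k₂

/-- Nilpotence over C is assumed outright because the connecting class need not inherit nilpotence
from c. -/
lemma IsGluing.cechBd {h h' : ℕ} (H₁ : CechBd p x₁ j h) (H₂ : CechBd p x₂ j h)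
    (H : CechNil p y (j - 1)) (H' : CechBd p y (j - 1) h') : CechBd p x j (h + h') := by
  rintro c hc ⟨m, hm⟩
  obtain ⟨β, hβ, hβc⟩ := G.exists_cocycle h₁ h₂ k₁ k₂ p
    (H₁ (cechMap f₁ h₁ j c) (by rw [cechD_cechMap, hc, map_zero])
      ⟨m, exists_cob_cechMap p f₁ h₁ hm⟩)
    (H₂ (cechMap f₂ h₂ j c) (by rw [cechD_cechMap, hc, map_zero])
      ⟨m, exists_cob_cechMap p f₂ h₂ hm⟩)
  exact hβc h' (H' β hβ (H β hβ))

lemma IsGluing.cechNil (H₁ : CechNil p x₁ j) (H₂ : CechNil p x₂ j)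
    (H : CechNil p y (j - 1)) : CechNil p x j := by
  intro c hc
  obtain ⟨m₁, hm₁⟩ := H₁ (cechMap f₁ h₁ j c) (by rw [cechD_cechMap, hc, map_zero])
  obtain ⟨m₂, hm₂⟩ := H₂ (cechMap f₂ h₂ j c) (by rw [cechD_cechMap, hc, map_zero])
  obtain ⟨β, hβ, hβc⟩ := G.exists_cocycle h₁ h₂ k₁ k₂ p
    (exists_cob_of_le p (le_max_left m₁ m₂) hm₁) (exists_cob_of_le p (le_max_right m₁ m₂) hm₂)
  obtain ⟨m', hm'⟩ := H β hβ
  exact ⟨_, hβc m' hm'⟩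

end GlueInvariants

/-! ### Local cohomology on arbitrary generators up to radical. -/

section LocalCohomology

variable (p : ℕ) [Fact p.Prime] {A : Type*} [CommRing A] [IsNoetherianRing A]
  [Algebra (ZMod p) A] {I : Ideal A} {n : ℕ} {y : Fin n → A}

lemma isNilpotentAction_locFrob_iff (h : I.radical = (Ideal.span (Set.range y)).radical) (j : ℤ) :
    IsNilpotentAction (locFrob p I j) ↔ CechNil p y j := by
  rw [locFrob, isNilpotentAction_cohFrob]
  exact (cechNil_and_cechBd_of_radical_eq p (by rw [span_gens, h]) j).1

lemma hslLC_le_iff (h : I.radical = (Ideal.span (Set.range y)).radical) (j : ℤ) (e : ℕ) :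
    hslLC p I j ≤ e ↔ CechBd p y j e := by
  rw [hslLC, locFrob, hsl_cohFrob_le]
  exact (cechNil_and_cechBd_of_radical_eq p (by rw [span_gens, h]) j).2 e

lemma hslLC_of_neg {j : ℤ} (hj : j < 0) : hslLC p I j = 0 := by
  have := (hslLC_le_iff p (y := gens I) (by rw [span_gens]) j 0).2 (cechBd_of_neg p _ hj 0)
  exact le_antisymm this bot_le

lemma isNilpotentAction_of_lt_fDepth {j : ℕ} (hj : (j : ℕ∞) < fDepth p I) :
    IsNilpotentAction (locFrob p I (j : ℤ)) := by
  by_contra h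
  exact absurd (iInf₂_le (f := fun (j : ℕ) (_ : ¬ IsNilpotentAction (locFrob p I (j : ℤ))) =>
    (j : ℕ∞)) j h) (not_le.2 hj)

end LocalCohomology

/-! ### Application to a local ring and its quotients. -/

section LocalRing

variable (p : ℕ) [Fact p.Prime] {R : Type*} [CommRing R] [Algebra (ZMod p) R] [IsLocalRing R]
  [IsNoetherianRing R]

open IsLocalRing

/-- The maximal ideal is, up to radical, generated by d elements, and their Čech complex is zero
above degree d. -/
lemma hslLC_eq_zero_of_dim_lt {d : ℕ} (hdim : ringKrullDim R = d) {j : ℤ} (hj : (d : ℤ) < j) :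
    hslLC p (maximalIdeal R) j = 0 := by
  obtain ⟨z, hz, hrad⟩ := exists_maximalIdeal_le_radical_of_dim_le hdim.le
  refine le_antisymm ((hslLC_le_iff p (y := z) ?_ j 0).2 (cechBd_of_lt p z hj 0)) bot_le
  refine le_antisymm (Ideal.radical_le_radical_iff.2 hrad) (Ideal.radical_mono ?_)
  rw [Ideal.span_le]
  rintro _ ⟨k, rfl⟩
  exact hz k

/-- The uniform bound of Frobenius test exponents of a weakly `F`-nilpotent local ring. -/
theorem fte_le_sum_hslLC {d : ℕ} (hdim : ringKrullDim R = d)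
    (hnil : ∀ j : ℕ, j < d → IsNilpotentAction (locFrob p (maximalIdeal R) (j : ℤ))) :
    fte p R ≤ ∑ j ∈ Finset.range (d + 1), (d.choose j : ℕ∞) * hslLC p (maximalIdeal R) j := by
  -- If some HSL number is infinite the right side is infinite, as the binomial coefficients in
  -- range are nonzero; otherwise all values are natural numbers.
  by_cases htop : ∃ j ∈ Finset.range (d + 1), hslLC p (maximalIdeal R) j = ⊤
  · obtain ⟨j, hj, h⟩ := htop
    have h0 : (d.choose j : ℕ∞) * hslLC p (maximalIdeal R) j = ⊤ := by
      rw [h, ENat.mul_top]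
      exact_mod_cast (Nat.choose_pos (Nat.lt_succ_iff.1 (Finset.mem_range.1 hj))).ne'
    refine le_top.trans (h0.symm.le.trans ?_)
    exact Finset.single_le_sum (f := fun j : ℕ => (d.choose j : ℕ∞) *
      hslLC p (maximalIdeal R) (j : ℤ)) (fun _ _ => zero_le) hj
  · push Not at htop
    let y := gens (maximalIdeal R)
    have hy : (maximalIdeal R).radical = (Ideal.span (Set.range y)).radical := by rw [span_gens]
    have hcoe : ∀ j ∈ Finset.range (d + 1), hslLC p (maximalIdeal R) j =
        ((hslLC p (maximalIdeal R) j).toNat : ℕ∞) := fun j hj =>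
      (ENat.natCast_toNat (htop j hj)).symm
    have := fte_le_sum p hdim (y := y)
      (fun k => (span_gens (maximalIdeal R)).le (Ideal.subset_span ⟨k, rfl⟩))
      (fun j hj => (isNilpotentAction_locFrob_iff p hy j).1 (hnil j hj))
      (h := fun j => (hslLC p (maximalIdeal R) j).toNat)
      (fun j hj => (hslLC_le_iff p hy j _).1
        (hcoe j (Finset.mem_range.2 (Nat.lt_succ_of_le hj))).le)
    refine this.trans (le_of_eq ?_)
    push_cast
    exact Finset.sum_congr rfl fun j hj => by rw [← hcoe j hj]

lemma isGluing_quotient {A : Type*} [CommRing A] {𝔞₁ 𝔞₂ 𝔟 : Ideal A} (h𝔟 : 𝔟 = 𝔞₁ ⊔ 𝔞₂)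
    (hinf : 𝔞₁ ⊓ 𝔞₂ = ⊥) :
    IsGluing (Ideal.Quotient.mk 𝔞₁) (Ideal.Quotient.mk 𝔞₂)
      (Ideal.Quotient.factor (show 𝔞₁ ≤ 𝔟 from h𝔟 ▸ le_sup_left))
      (Ideal.Quotient.factor (show 𝔞₂ ≤ 𝔟 from h𝔟 ▸ le_sup_right)) where
  comm := rfl
  surj₁ := Ideal.Quotient.mk_surjective
  surj₂ := Ideal.Quotient.mk_surjective
  surj := Ideal.Quotient.factor_surjective _
  inj r h₁ h₂ := by
    rw [Ideal.Quotient.eq_zero_iff_mem] at h₁ h₂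
    have : r ∈ 𝔞₁ ⊓ 𝔞₂ := ⟨h₁, h₂⟩
    rwa [hinf, Ideal.mem_bot] at this
  exact r h := by
    rw [Ideal.Quotient.factor_mk, Ideal.Quotient.eq_zero_iff_mem, h𝔟] at h
    obtain ⟨s, hs, t, ht, rfl⟩ := Submodule.mem_sup.1 h
    exact ⟨s, t, Ideal.Quotient.eq_zero_iff_mem.2 hs, Ideal.Quotient.eq_zero_iff_mem.2 ht, rfl⟩

/-- Allows the cohomology of each quotient to be computed on the images of one fixed generating
sequence of 𝔪, as the gluing of Čech complexes demands. -/
lemma quotMax_radical (𝔞 : Ideal R) :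
    (quotMax 𝔞).radical = (Ideal.span (Set.range fun k =>
      Ideal.Quotient.mk 𝔞 (gens (maximalIdeal R) k))).radical := by
  rw [quotMax]
  conv_lhs => rw [← span_gens (maximalIdeal R), Ideal.map_span, ← Set.range_comp]
  rfl

variable {𝔞₁ 𝔞₂ 𝔟 : Ideal R} (h𝔟 : 𝔟 = 𝔞₁ ⊔ 𝔞₂) (hinf : 𝔞₁ ⊓ 𝔞₂ = ⊥)
include h𝔟 hinf

lemma hslLC_le_of_gluing {j : ℤ}
    (hnil : IsNilpotentAction (locFrob p (quotMax 𝔟) (j - 1))) :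
    hslLC p (maximalIdeal R) j ≤ hslLC p (quotMax 𝔟) (j - 1) +
      max (hslLC p (quotMax 𝔞₁) j) (hslLC p (quotMax 𝔞₂) j) := by
  generalize hu : hslLC p (quotMax 𝔟) (j - 1) = u
  generalize hv : max (hslLC p (quotMax 𝔞₁) j) (hslLC p (quotMax 𝔞₂) j) = v
  induction u using ENat.recTopCoe with
  | top => simp
  | coe u =>
    induction v using ENat.recTopCoe with
    | top => simp
    | coe v =>
      rw [add_comm]
      refine (hslLC_le_iff p (y := gens (maximalIdeal R)) (by rw [span_gens]) j (v + u)).2 ?_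
      exact (isGluing_quotient h𝔟 hinf).cechBd p (fun _ => rfl) (fun _ => rfl) (fun _ => rfl)
        (fun _ => rfl)
        ((hslLC_le_iff p (quotMax_radical 𝔞₁) j v).1 ((le_max_left _ _).trans hv.le))
        ((hslLC_le_iff p (quotMax_radical 𝔞₂) j v).1 ((le_max_right _ _).trans hv.le))
        ((isNilpotentAction_locFrob_iff p (quotMax_radical 𝔟) (j - 1)).1 hnil)
        ((hslLC_le_iff p (quotMax_radical 𝔟) (j - 1) u).1 hu.le)

lemma isNilpotentAction_of_gluing {j : ℤ}
    (hnil₁ : IsNilpotentAction (locFrob p (quotMax 𝔞₁) j))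
    (hnil₂ : IsNilpotentAction (locFrob p (quotMax 𝔞₂) j))
    (hnil : IsNilpotentAction (locFrob p (quotMax 𝔟) (j - 1))) :
    IsNilpotentAction (locFrob p (maximalIdeal R) j) :=
  (isNilpotentAction_locFrob_iff p (y := gens (maximalIdeal R)) (by rw [span_gens]) j).2
    ((isGluing_quotient h𝔟 hinf).cechNil p (fun _ => rfl) (fun _ => rfl) (fun _ => rfl)
      (fun _ => rfl)
      ((isNilpotentAction_locFrob_iff p (quotMax_radical 𝔞₁) j).1 hnil₁)
      ((isNilpotentAction_locFrob_iff p (quotMax_radical 𝔞₂) j).1 hnil₂)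
      ((isNilpotentAction_locFrob_iff p (quotMax_radical 𝔟) (j - 1)).1 hnil))

-- Covers j = 0, where the degree is -1 and the complex vanishes.
omit h𝔟 hinf [IsLocalRing R] in
lemma isNilpotentAction_pred {I : Ideal R} {j : ℕ}
    (h : ∀ i : ℕ, i + 1 = j → IsNilpotentAction (locFrob p I (i : ℤ))) :
    IsNilpotentAction (locFrob p I ((j : ℤ) - 1)) := by
  cases j with
  | zero =>
    exact (isNilpotentAction_locFrob_iff p (y := gens I) (by rw [span_gens]) _).2
      (cechNil_of_neg p _ (by simp))
  | succ i =>
    have := h i rfl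
    rwa [Nat.cast_succ, add_sub_cancel_right]

-- The term j = 0 of the first sum may be added freely because u 0 = 0; in the application it is the
-- HSL number in degree -1.
omit [IsLocalRing R] [IsNoetherianRing R] [Algebra (ZMod p) R] h𝔟 hinf [Fact p.Prime] in
lemma sum_choose_mul_le {d e : ℕ} {u v w : ℕ → ℕ∞} (hu : u 0 = 0)
    (h : ∀ j, j < e + 1 → w j ≤ u j + v j) :
    ∑ j ∈ Finset.range (e + 1), (d.choose j : ℕ∞) * w j ≤
      ∑ j ∈ Finset.Icc 1 e, (d.choose j : ℕ∞) * u j +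
      ∑ j ∈ Finset.Icc 0 e, (d.choose j : ℕ∞) * v j := by
  have h1 : Finset.range (e + 1) = Finset.Icc 0 e := by
    ext j
    simp only [Finset.mem_range, Finset.mem_Icc]
    omega
  have h2 : ∑ j ∈ Finset.Icc 1 e, (d.choose j : ℕ∞) * u j =
      ∑ j ∈ Finset.range (e + 1), (d.choose j : ℕ∞) * u j := by
    refine Finset.sum_subset (fun j hj => ?_) fun j hj hj' => ?_
    · simp only [Finset.mem_range, Finset.mem_Icc] at hj ⊢
      omega
    · have : j = 0 := by
        simp only [Finset.mem_range, Finset.mem_Icc] at hj hj'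
        omega
      rw [this, hu, mul_zero]
  rw [h2, ← h1, ← Finset.sum_add_distrib]
  refine Finset.sum_le_sum fun j hj => ?_
  rw [← mul_add]
  exact mul_le_mul_right (h j (Finset.mem_range.1 hj)) _

end LocalRing

end FrobeniusGluing

end

/-! ### The theorem. -/

open FrobeniusGluing in
theorem mainTheorem12 (p : ℕ) [Fact p.Prime] {R : Type*} [CommRing R] [Algebra (ZMod p) R]
    [IsLocalRing R] [IsNoetherianRing R] (hF : FFinite p R)
    (d : ℕ) (hd : 2 ≤ d) (hdim : ringKrullDim R = d)
    (𝔞₁ 𝔞₂ 𝔟 : Ideal R) (h𝔟 : 𝔟 = 𝔞₁ ⊔ 𝔞₂) (hinf : 𝔞₁ ⊓ 𝔞₂ = ⊥)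
    (hdim₁ : ringKrullDim (R ⧸ 𝔞₁) = d) (hdim₂ : ringKrullDim (R ⧸ 𝔞₂) = d)
    (h : ℕ → ℕ∞)
    (hh : ∀ j : ℕ, h j = max (hslLC p (quotMax 𝔞₁) j) (hslLC p (quotMax 𝔞₂) j)) :
    (∀ j : ℕ, (j : ℕ∞) ≤ fDepth p (quotMax 𝔟) →
      hslLC p (IsLocalRing.maximalIdeal R) j ≤ hslLC p (quotMax 𝔟) ((j : ℤ) - 1) + h j) ∧
    (IsWeaklyFNilpotent p (quotMax 𝔞₁) → IsWeaklyFNilpotent p (quotMax 𝔞₂) →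
      IsWeaklyFNilpotent p (quotMax 𝔟) →
      (ringKrullDim (R ⧸ 𝔟) = d →
        (∀ j : ℕ, hslLC p (IsLocalRing.maximalIdeal R) j ≤
          hslLC p (quotMax 𝔟) ((j : ℤ) - 1) + h j) ∧
        fte p R ≤
          ∑ j ∈ Finset.Icc 1 d, (d.choose j : ℕ∞) * hslLC p (quotMax 𝔟) ((j : ℤ) - 1) +
          ∑ j ∈ Finset.Icc 0 d, (d.choose j : ℕ∞) * h j) ∧
      (ringKrullDim (R ⧸ 𝔟) = ((d - 1 : ℕ) : WithBot ℕ∞) →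
        (∀ j : ℕ, j < d → hslLC p (IsLocalRing.maximalIdeal R) j ≤
          hslLC p (quotMax 𝔟) ((j : ℤ) - 1) + h j) ∧
        fte p R ≤
          hslLC p (IsLocalRing.maximalIdeal R) d +
          ∑ j ∈ Finset.Icc 1 (d - 1), (d.choose j : ℕ∞) * hslLC p (quotMax 𝔟) ((j : ℤ) - 1) +
          ∑ j ∈ Finset.Icc 0 (d - 1), (d.choose j : ℕ∞) * h j)) := by
  have star : ∀ j : ℕ, (∀ i : ℕ, i + 1 = j → IsNilpotentAction (locFrob p (quotMax 𝔟) (i : ℤ))) →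
      hslLC p (IsLocalRing.maximalIdeal R) j ≤ hslLC p (quotMax 𝔟) ((j : ℤ) - 1) + h j := by
    intro j hj
    rw [hh]
    exact hslLC_le_of_gluing p h𝔟 hinf (isNilpotentAction_pred p hj)
  refine ⟨fun j hj => star j fun i hi => ?_, fun hw₁ hw₂ hw => ⟨fun hb => ?_, fun hb => ?_⟩⟩
  · refine isNilpotentAction_of_lt_fDepth p (lt_of_lt_of_le ?_ hj)
    exact_mod_cast (by omega : i < j)
  · have hnil : ∀ j : ℕ, j < d →
        IsNilpotentAction (locFrob p (IsLocalRing.maximalIdeal R) (j : ℤ)) := by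
      intro j hj
      refine isNilpotentAction_of_gluing p h𝔟 hinf (hw₁ j ?_) (hw₂ j ?_)
        (isNilpotentAction_pred p fun i hi => hw i ?_)
      · rw [hdim₁]; exact_mod_cast hj
      · rw [hdim₂]; exact_mod_cast hj
      · rw [hb]; exact_mod_cast (by omega : i < d)
    have star' : ∀ j : ℕ, hslLC p (IsLocalRing.maximalIdeal R) j ≤
        hslLC p (quotMax 𝔟) ((j : ℤ) - 1) + h j := by
      intro j
      rcases lt_or_ge d j with hj | hj
      -- Above the dimension the left side vanishes, so no nilpotence over R/𝔟 is needed there; for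
      -- j ≤ d one has j - 1 < d = dim R/𝔟.
      · rw [hslLC_eq_zero_of_dim_lt p hdim (by exact_mod_cast hj)]
        exact zero_le
      · refine star j fun i hi => hw i ?_
        rw [hb]; exact_mod_cast (by omega : i < d)
    refine ⟨star', (fte_le_sum_hslLC p hdim hnil).trans ?_⟩
    exact sum_choose_mul_le (u := fun j : ℕ => hslLC p (quotMax 𝔟) ((j : ℤ) - 1))
      (hslLC_of_neg p (by simp)) fun j _ => star' j
  · have hnil : ∀ j : ℕ, j < d →
        IsNilpotentAction (locFrob p (IsLocalRing.maximalIdeal R) (j : ℤ)) := by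
      intro j hj
      refine isNilpotentAction_of_gluing p h𝔟 hinf (hw₁ j ?_) (hw₂ j ?_)
        (isNilpotentAction_pred p fun i hi => hw i ?_)
      · rw [hdim₁]; exact_mod_cast hj
      · rw [hdim₂]; exact_mod_cast hj
      · rw [hb]; exact_mod_cast (by omega : i < d - 1)
    have star' : ∀ j : ℕ, j < d → hslLC p (IsLocalRing.maximalIdeal R) j ≤
        hslLC p (quotMax 𝔟) ((j : ℤ) - 1) + h j := by
      intro j hj
      refine star j fun i hi => hw i ?_
      rw [hb]; exact_mod_cast (by omega : i < d - 1)
    refine ⟨star', (fte_le_sum_hslLC p hdim hnil).trans ?_⟩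
    -- The term j = d is kept as it stands: its bound would need nilpotence of H^{d-1}(R/𝔟), the top
    -- degree of R/𝔟, which weak F-nilpotence does not give.
    rw [Finset.sum_range_succ, Nat.choose_self, Nat.cast_one, one_mul, add_comm, add_assoc]
    gcongr
    obtain ⟨e, rfl⟩ : ∃ e, d = e + 1 := ⟨d - 1, by omega⟩
    rw [Nat.add_sub_cancel]
    exact sum_choose_mul_le (u := fun j : ℕ => hslLC p (quotMax 𝔟) ((j : ℤ) - 1))
      (hslLC_of_neg p (by simp)) fun j hj => star' j hj
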